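/- Let $\mathcal F$ be an ordinary differential field of characteristic zero with derivation $\delta$. Let $\mathcal A=\{A_1,\dots,A_p\}$ be an auto-reduced set of differential polynomials in $\mathcal F\{y_1,\dots,y_n\}$ under a fixed ranking $\mathscr R$ (no $A_i$ lies in $\mathcal F$, and for $i\neq j$, $A_i$ contains no proper derivative of the leader of $A_j$ and has lower degree than $A_j$ in that leader), and let $f\in\mathcal F\{y_1,\dots,y_n\}$. Put $h=\mathrm{ord}(f)$, $D=\deg(f)$, $e=\max_i \mathrm{ord}(A_i)$ and $m=\max_i\deg(A_i)$, where $\deg$ is the total degree, the order of an element of $\mathcal F$ and the degree of $0$ count as $0$, and so does a maximum over the empty set. The pseudo-remainder of a polynomial $g$ by a polynomial $B$ with respect to a variable $v$ that occurs in $B$ is the unique $g'$ with $I^l g=qB+g'$ for some polynomial $q$ and $\deg_v g'<\deg_v B$, where $I$ is the coefficient of the highest power of $v$ in $B$ and $l=\max(\deg_v g-\deg_v B+1,\,0)$. The differential remainder $r$ of $f$ with respect to $\mathcal A$ is the last term of the sequence that starts with $f$ and takes pseudo-remainders successively by the polynomials $A_i^{(k)}$ ($1\le i\le p$, $0\le k\le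 h$), each with respect to its leader, in order of decreasing leader. Then $r$ exists and is unique, it is reduced with respect to every $A_i$, and $$\prod_{i=1}^p S_i^{a_i} I_i^{b_i}\cdot f\equiv r \pmod{[\mathcal A]}$$ for some $a_i,b_i\in\mathbb N$, where $I_i$ and $S_i$ are the initial and the separant of $A_i$ and $[\mathcal A]$ is the differential ideal generated by $\mathcal A$. Moreover $$\deg(r)\le (m+1)^{p(h+1)}(D+1)-1,$$ and the coefficients of $r$ can be computed from those of $A_1,\dots,A_p$ and $f$ with at most $$O\big(p(h+1)\big)\,(m+1)^{O(np(h+1)(e+h+1))}\,(D+1)^{O(n(e+h+1))}$$ operations in $\mathcal F$, where the constants in the three $O$'s are absolute. That is, for all $n,p,h,e,m,D$ and $\mathscr R$ there is an algebraic computation tree, not depending on $\mathcal F$, $\mathcal A$ and $f$, that computes $r$ for all data with these parameters; its operations are the constant $1$, $+,-,\times,/$, the derivation $\delta$ of $\mathcal F$ and zero tests, each of cost one. -/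

import Mathlib

namespace DiffRed

/-! ### Differential polynomials -/

/-- The derivatives `y_j^(k)` of `n` differential indeterminates; `(j, k)` stands for `y_j^(k)`. -/
abbrev Deriv (n : ℕ) : Type := Fin n × ℕ

/-- Monomials in the derivatives `y_j^(k)`, given by their exponents. -/
abbrev Mon (n : ℕ) : Type := Deriv n →₀ ℕ

/-- The ring `F{y_1, …, y_n} = F[y_j^(k) : j, k]` of differential polynomials. -/
abbrev DiffPoly (F : Type*) [Field F] (n : ℕ) : Type _ := MvPolynomial (Deriv n) F

section Ring

variable {F : Type*} [Field F] [Differential F] {n : ℕ}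

/-- Apply the derivation of `F` to every coefficient. -/
noncomputable def coeffDeriv (f : DiffPoly F n) : DiffPoly F n :=
  ∑ s ∈ f.support, MvPolynomial.monomial s (Differential.deriv (f.coeff s))

theorem coeff_coeffDeriv (f : DiffPoly F n) (s : Mon n) :
    (coeffDeriv f).coeff s = Differential.deriv (f.coeff s) := by
  classical
  rw [coeffDeriv, MvPolynomial.coeff_sum]
  simp only [MvPolynomial.coeff_monomial, Finset.sum_ite_eq']
  split_ifs with h
  · rfl
  · rw [MvPolynomial.notMem_support_iff.mp h, map_zero]

theorem coeffDeriv_mul (f g : DiffPoly F n) :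
    coeffDeriv (f * g) = f * coeffDeriv g + g * coeffDeriv f := by
  classical
  ext s
  rw [coeff_coeffDeriv, mul_comm g, MvPolynomial.coeff_add]
  simp only [MvPolynomial.coeff_mul, map_sum, coeff_coeffDeriv, Derivation.leibniz, smul_eq_mul,
    ← Finset.sum_add_distrib]
  exact Finset.sum_congr rfl fun _ _ => by ring

/-- The derivation `δ` of `F{y_1, …, y_n}`: it extends the derivation of `F` and sends `y_j^(k)`
to `y_j^(k+1)`. -/
noncomputable def δ : Derivation ℤ (DiffPoly F n) (DiffPoly F n) :=
  Derivation.mk'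
    (AddMonoidHom.toIntLinearMap
      { toFun := fun f => coeffDeriv f +
          MvPolynomial.mkDerivation F
            (fun v : Deriv n => (MvPolynomial.X (v.1, v.2 + 1) : DiffPoly F n)) f
        map_zero' := by simp [coeffDeriv]
        map_add' := fun f g => by
          have h : coeffDeriv (f + g) = coeffDeriv f + coeffDeriv g := by
            ext s
            simp [coeff_coeffDeriv]
          rw [h, map_add]
          ring })
    (fun f g => by
      simp only [AddMonoidHom.coe_toIntLinearMap, AddMonoidHom.coe_mk, ZeroHom.coe_mk,
        coeffDeriv_mul, Derivation.leibniz, smul_eq_mul]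
      ring)

theorem δ_C (a : F) :
    δ (MvPolynomial.C a : DiffPoly F n) = MvPolynomial.C (Differential.deriv a) := by
  have h : δ (MvPolynomial.C a : DiffPoly F n) = coeffDeriv (MvPolynomial.C a) +
      MvPolynomial.mkDerivation F
        (fun v : Deriv n => (MvPolynomial.X (v.1, v.2 + 1) : DiffPoly F n))
        (MvPolynomial.C a) := rfl
  rw [h, MvPolynomial.derivation_C, add_zero]
  classical
  ext s
  rw [coeff_coeffDeriv, MvPolynomial.coeff_C, MvPolynomial.coeff_C]
  split_ifs <;> simp

theorem δ_X (v : Deriv n) :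
    δ (MvPolynomial.X v : DiffPoly F n) = MvPolynomial.X (v.1, v.2 + 1) := by
  have h : δ (MvPolynomial.X v : DiffPoly F n) = coeffDeriv (MvPolynomial.X v) +
      MvPolynomial.mkDerivation F
        (fun v : Deriv n => (MvPolynomial.X (v.1, v.2 + 1) : DiffPoly F n))
        (MvPolynomial.X v) := rfl
  rw [h, MvPolynomial.mkDerivation_X]
  classical
  have h0 : coeffDeriv (MvPolynomial.X v : DiffPoly F n) = 0 := by
    ext s
    rw [coeff_coeffDeriv, MvPolynomial.coeff_X, MvPolynomial.coeff_zero]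
    split_ifs <;> simp
  rw [h0, zero_add]

/-- The order of `f`: the largest `k` such that some `y_j^(k)` occurs in `f` (and `0` if `f ∈ F`). -/
noncomputable def order (f : DiffPoly F n) : ℕ := f.vars.sup Prod.snd

/-- The differential ideal `[A]` generated by `A_1, …, A_p`. -/
noncomputable def diffIdeal {p : ℕ} (A : Fin p → DiffPoly F n) : Ideal (DiffPoly F n) :=
  Ideal.span {g | ∃ (i : Fin p) (k : ℕ), g = δ^[k] (A i)}

/-- The coefficient of the highest power of `v` in `g`, where `g` is regarded as a univariate
polynomial in `v`; it is the initial of `g` when `v` is the leader of `g`. -/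
noncomputable def initial (v : Deriv n) (g : DiffPoly F n) : DiffPoly F n :=
  ∑ s ∈ g.support with s v = g.degreeOf v, MvPolynomial.monomial (s.erase v) (g.coeff s)

/-- The partial derivative of `g` with respect to `v`; it is the separant of `g` when `v` is the
leader of `g`. -/
noncomputable def separant (v : Deriv n) (g : DiffPoly F n) : DiffPoly F n :=
  MvPolynomial.pderiv v g

end Ring

/-! ### Rankings, leaders, auto-reduced sets -/

/-- A ranking: a (strict) total order on the derivatives `y_j^(k)` such that `v < δ v`, and
`v < w` implies `δ v < δ w`. -/
structure Ranking (n : ℕ) where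
  lt : Deriv n → Deriv n → Prop
  irrefl : ∀ v, ¬ lt v v
  trans : ∀ u v w, lt u v → lt v w → lt u w
  total : ∀ v w, lt v w ∨ v = w ∨ lt w v
  lt_deriv : ∀ v, lt v (v.1, v.2 + 1)
  deriv_lt_deriv : ∀ v w, lt v w → lt (v.1, v.2 + 1) (w.1, w.2 + 1)

section Reduction

variable {F : Type*} [Field F] {n p : ℕ}

/-- `v` is the leader of `f`: the greatest derivative that occurs in `f`. Every `f ∉ F` has exactly
one leader, and elements of `F` have none. -/
def Ranking.IsLeader (R : Ranking n) (f : DiffPoly F n) (v : Deriv n) : Prop :=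
  v ∈ f.vars ∧ ∀ w ∈ f.vars, w ≠ v → R.lt w v

/-- `f` is reduced with respect to `g`: no proper derivative of the leader of `g` occurs in `f`, and
`f` has lower degree than `g` in the leader of `g`. -/
def Ranking.IsReduced (R : Ranking n) (f g : DiffPoly F n) : Prop :=
  ∀ v, R.IsLeader g v →
    (∀ k : ℕ, 1 ≤ k → (v.1, v.2 + k) ∉ f.vars) ∧ f.degreeOf v < g.degreeOf v

/-- `A_1, …, A_p` is an auto-reduced set: no `A_i` is in `F`, and each `A_i` is reduced with respect
to all the others. -/
def Ranking.IsAutoReduced (R : Ranking n) (A : Fin p → DiffPoly F n) : Prop :=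
  (∀ i, ∃ v, R.IsLeader (A i) v) ∧ ∀ i j, i ≠ j → R.IsReduced (A i) (A j)

/-- `r` is the algebraic pseudo-remainder of `f` by `g` in the variable `v`: with
`l = max (deg_v f - deg_v g + 1, 0)` there is `q` such that `init(g)^l f = q g + r` and
`deg_v r < deg_v g`. -/
def IsPseudoRemainder (v : Deriv n) (g f r : DiffPoly F n) : Prop :=
  (∃ q, initial v g ^ (f.degreeOf v + 1 - g.degreeOf v) * f = q * g + r) ∧
    r.degreeOf v < g.degreeOf v

/-- `r` is the last term of the pseudo-remainder sequence that starts with `f` and takes the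
pseudo-remainders by the listed polynomials, in the listed variables, one after the other. -/
inductive IsIteratedPseudoRemainder :
    List (Deriv n × DiffPoly F n) → DiffPoly F n → DiffPoly F n → Prop
  | nil (f : DiffPoly F n) : IsIteratedPseudoRemainder [] f f
  | cons (v : Deriv n) (g : DiffPoly F n) (L : List (Deriv n × DiffPoly F n))
      (f f' r : DiffPoly F n) (h : IsPseudoRemainder v g f f')
      (h' : IsIteratedPseudoRemainder L f' r) : IsIteratedPseudoRemainder ((v, g) :: L) f r

/-- `r` is the differential remainder of `f` with respect to the auto-reduced set `A`: with `u i` the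
leader of `A i`, list the derivatives `δ^k (A i)`, `k ≤ ord f`, in order of decreasing leader
`δ^k (u i)`, and take pseudo-remainders by them one after the other, starting from `f`.
(In this process no `δ^k (A i)` with `k > ord f` ever has anything to reduce.) -/
def Ranking.IsDifferentialRemainder [Differential F] (R : Ranking n) (A : Fin p → DiffPoly F n)
    (f r : DiffPoly F n) : Prop :=
  ∃ (u : Fin p → Deriv n) (L : List (Fin p × ℕ)),
    (∀ i, R.IsLeader (A i) (u i)) ∧
    (∀ i k, (i, k) ∈ L ↔ k ≤ order f) ∧
    L.Pairwise (fun a b => R.lt ((u b.1).1, (u b.1).2 + b.2) ((u a.1).1, (u a.1).2 + a.2)) ∧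
    IsIteratedPseudoRemainder
      (L.map fun a => (((u a.1).1, (u a.1).2 + a.2), δ^[a.2] (A a.1))) f r

end Reduction

/-! ### Algebraic computation trees over a differential field -/

/-- The arithmetic operations of a field. -/
inductive ArithOp : Type
  | plus
  | minus
  | times
  | divide

/-- The value of an arithmetic operation (division by zero, which a program can avoid by a zero
test, is given the value zero). -/
def ArithOp.eval {F : Type*} [Field F] : ArithOp → F → F → F
  | plus, a, b => a + b
  | minus, a, b => a - b
  | times, a, b => a * b
  | divide, a, b => a / b

/-- An operand: an input `inl i`, or a work register `inr k`. -/
abbrev Operand (I : Type) : Type := I ⊕ ℕ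

/-- Algebraic computation trees with inputs indexed by `I` and outputs indexed by `O`. A tree cannot
mention elements of the field: it computes with its inputs and the constant `1` only. The result of
an operation is stored in the work register `dst`. -/
inductive CompTree (I O : Type) : Type
  /-- Stop; `out` tells where each of the output values stands. -/
  | halt (out : O → Operand I) : CompTree I O
  /-- Store the constant `1`. -/
  | one (dst : ℕ) (next : CompTree I O) : CompTree I O
  /-- Carry out an arithmetic operation. -/
  | arith (op : ArithOp) (dst : ℕ) (a b : Operand I) (next : CompTree I O) : CompTree I O
  /-- Apply the derivation of the field. -/
  | derive (dst : ℕ) (a : Operand I) (next : CompTree I O) : CompTree I O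
  /-- Test for zero and branch. -/
  | ifZero (a : Operand I) (yes no : CompTree I O) : CompTree I O

section Run

variable {F : Type*} [Field F] {I O : Type}

/-- The value of an operand, for the inputs `x` and the register contents `M`. -/
def Operand.val (x : I → F) (M : ℕ → F) : Operand I → F
  | Sum.inl i => x i
  | Sum.inr k => M k

variable [Differential F]

open Classical in
/-- Run a tree on the inputs `x`, from register contents `M`: the pair of the outputs and of the
number of operations (constants, arithmetic operations, derivations and zero tests, each of cost
`1`) on the path that is taken. -/
noncomputable def CompTree.runFrom (x : I → F) : CompTree I O → (ℕ → F) → (O → F) × ℕ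
  | halt out, M => (fun o => Operand.val x M (out o), 0)
  | one dst next, M =>
      let z := runFrom x next (Function.update M dst 1)
      (z.1, z.2 + 1)
  | arith op dst a b next, M =>
      let z := runFrom x next
        (Function.update M dst (op.eval (Operand.val x M a) (Operand.val x M b)))
      (z.1, z.2 + 1)
  | derive dst a next, M =>
      let z := runFrom x next (Function.update M dst (Differential.deriv (Operand.val x M a)))
      (z.1, z.2 + 1)
  | ifZero a yes no, M =>
      let z := if Operand.val x M a = 0 then runFrom x yes M else runFrom x no M
      (z.1, z.2 + 1)

/-- The outputs of a tree on the inputs `x`; all work registers start with the value `0`. -/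
noncomputable def CompTree.output (T : CompTree I O) (x : I → F) : O → F :=
  (T.runFrom x fun _ => 0).1

/-- The number of operations that a tree carries out on the inputs `x`. -/
noncomputable def CompTree.cost (T : CompTree I O) (x : I → F) : ℕ :=
  (T.runFrom x fun _ => 0).2

end Run

/-- The inputs of a reduction: the coefficients of `A_1, …, A_p` and those of `f`. -/
noncomputable def coeffInput {F : Type*} [Field F] {n p : ℕ} (A : Fin p → DiffPoly F n)
    (f : DiffPoly F n) : (Fin p × Mon n) ⊕ Mon n → F
  | Sum.inl (i, s) => (A i).coeff s
  | Sum.inr s => f.coeff s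

end DiffRed

open DiffRed

universe u

/-! One elimination step replaces `f` by `I f - c v^j g`, where `I` is the initial of `g` in `v`,
`d` its degree in `v`, and `c` the coefficient of `v^(d+j)` in `f`. This lowers the degree in `v`
and raises the total degree by at most `deg g - d`. A pseudo-division takes at most `deg f` such
steps because `d ≥ 1`, so it multiplies `deg + 1` by at most `m + 1`. Derivation does not raise the
total degree, and there are `p (h + 1)` divisors, which gives the degree bound.

By the chain rule a proper derivative of `A_i` is linear in its leader with coefficient the separant
`S_i`. Hence every multiplier in the process is an `I_i` or an `S_i`, and the congruence follows by
collecting exponents. Auto-reducedness makes the leaders belong to distinct indeterminates, so the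
derived leaders are distinct and their decreasing order is unique. A divisor used later has a
smaller leader and does not contain the earlier ones, so a degree once lowered stays low.
Derivatives of a leader of order above `h` never appear. This gives reducedness; uniqueness is that
of pseudo-remainders.

For the cost, put `N + 1 = (m+1)^(p(h+1)) (D+1)`. All polynomials involved have degree at most `N`
and use `n(e+h+1)` derivatives, so they lie in a box of `B = (N+1)^(n(e+h+1))` monomials. Schoolbook
products cost `O(B^2)`, and a pseudo-remainder takes at most `B` elimination steps. The total is
`O(p(h+1)) B^3`.

Uniformity is obtained by treating all fields and data with the given parameters as instances `ω` of
one problem; a value is then a family indexed by `ω`. Zero tests on coefficients split the instances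
into classes on which supports are constant. Leaders and degrees, which steer the computation, are
constant there as well. `Solves` states that a tree exists for the remaining task, and `Gets` states
that code for some values can be put in front of any such tree. -/

namespace DiffRed

/-! ### Pseudo-division in one variable: existence, uniqueness and degrees -/

section Algebra

open MvPolynomial

variable {F : Type*} [Field F] {n : ℕ}

/-- The coefficient of `v ^ e` in `f`, regarded as a univariate polynomial in `v`. -/
noncomputable def coeffAt (v : Deriv n) (e : ℕ) (f : DiffPoly F n) : DiffPoly F n :=
  ∑ s ∈ f.support with s v = e, monomial (s.erase v) (f.coeff s)

theorem initial_eq_coeffAt (v : Deriv n) (g : DiffPoly F n) :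
    initial v g = coeffAt v (g.degreeOf v) g := rfl

theorem coeff_coeffAt (v : Deriv n) (e : ℕ) (f : DiffPoly F n) (t : Mon n) :
    (coeffAt v e f).coeff t = if t v = 0 then f.coeff (t + Finsupp.single v e) else 0 := by
  classical
  rw [coeffAt, coeff_sum]
  simp only [coeff_monomial]
  split_ifs with h
  · have key : ∀ s : Mon n, s v = e → (s.erase v = t ↔ s = t + Finsupp.single v e) := by
      intro s hs
      constructor
      · rintro rfl
        rw [← hs, Finsupp.erase_add_single]
      · rintro rfl
        rw [Finsupp.erase_add, Finsupp.erase_single, add_zero,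
          Finsupp.erase_of_notMem_support (by simpa using h)]
    rw [Finset.sum_congr rfl (g := fun s => if s = t + Finsupp.single v e then f.coeff s else 0)
      fun s hs => by simp only [key s (Finset.mem_filter.mp hs).2]]
    rw [Finset.sum_ite_eq']
    split_ifs with h1
    · rfl
    · rw [Finset.mem_filter, not_and_or] at h1
      rcases h1 with h1 | h1
      · exact (notMem_support_iff.mp h1).symm
      · exact absurd (by simp [h]) h1
  · refine Finset.sum_eq_zero fun s _ => if_neg ?_
    rintro rfl
    simp at h

theorem mem_support_coeffAt {v : Deriv n} {e : ℕ} {f : DiffPoly F n} {t : Mon n} :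
    t ∈ (coeffAt v e f).support ↔ t v = 0 ∧ t + Finsupp.single v e ∈ f.support := by
  rw [mem_support_iff, coeff_coeffAt, mem_support_iff]
  split_ifs with h <;> simp [h]

theorem degreeOf_coeffAt_self (v : Deriv n) (e : ℕ) (f : DiffPoly F n) :
    (coeffAt v e f).degreeOf v = 0 :=
  Nat.le_zero.mp (degreeOf_le_iff.mpr fun _ hs => (mem_support_coeffAt.mp hs).1.le)

theorem degreeOf_coeffAt_le (v w : Deriv n) (e : ℕ) (f : DiffPoly F n) :
    (coeffAt v e f).degreeOf w ≤ f.degreeOf w := by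
  refine degreeOf_le_iff.mpr fun s hs => ?_
  have := (degreeOf_le_iff (n := w)).mp le_rfl _ (mem_support_coeffAt.mp hs).2
  simp only [Finsupp.add_apply] at this
  lia

theorem vars_subset_of_degreeOf_le {f g : DiffPoly F n}
    (h : ∀ w, f.degreeOf w ≤ g.degreeOf w) : f.vars ⊆ g.vars := by
  intro w
  rw [mem_vars_iff_degreeOf_ne_zero, mem_vars_iff_degreeOf_ne_zero]
  have := h w
  lia

theorem vars_coeffAt_subset (v : Deriv n) (e : ℕ) (f : DiffPoly F n) :
    (coeffAt v e f).vars ⊆ f.vars :=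
  vars_subset_of_degreeOf_le fun w => degreeOf_coeffAt_le v w e f

theorem totalDegree_coeffAt_le (v : Deriv n) (e : ℕ) (f : DiffPoly F n) :
    (coeffAt v e f).totalDegree ≤ f.totalDegree - e := by
  refine Finset.sup_le fun s hs => ?_
  have := le_totalDegree (mem_support_coeffAt.mp hs).2
  rw [Finsupp.sum_add_index' (by simp) (by simp), Finsupp.sum_single_index rfl] at this
  lia

theorem coeffAt_eq_zero_of_lt {v : Deriv n} {e : ℕ} {f : DiffPoly F n}
    (h : f.totalDegree < e) : coeffAt v e f = 0 := by
  refine support_eq_empty.mp (Finset.eq_empty_of_forall_notMem fun s hs => ?_)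
  have := le_totalDegree (mem_support_coeffAt.mp hs).2
  rw [Finsupp.sum_add_index' (by simp) (by simp), Finsupp.sum_single_index rfl] at this
  lia

theorem coeff_mul_X_pow_coeffAt (v : Deriv n) (e : ℕ) (f : DiffPoly F n) (s : Mon n) :
    (coeffAt v e f * X v ^ e).coeff s = if s v = e then f.coeff s else 0 := by
  rw [X_pow_eq_monomial, coeff_mul_monomial', mul_one, coeff_coeffAt]
  by_cases h : Finsupp.single v e ≤ s
  · have hv : e ≤ s v := by simpa using h v
    rw [if_pos h, tsub_add_cancel_of_le h]
    refine if_congr ?_ rfl rfl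
    rw [Finsupp.tsub_apply, Finsupp.single_eq_same]
    lia
  · rw [if_neg h, if_neg]
    rintro rfl
    exact h (by rw [Finsupp.single_le_iff])

theorem degreeOf_sub_lead_lt {v : Deriv n} {e : ℕ} {f : DiffPoly F n} (he : 0 < e)
    (h : f.degreeOf v ≤ e) : (f - coeffAt v e f * X v ^ e).degreeOf v < e := by
  refine (degreeOf_lt_iff he).mpr fun s hs => ?_
  rw [mem_support_iff, coeff_sub, coeff_mul_X_pow_coeffAt] at hs
  split_ifs at hs with h1
  · simp at hs
  · have := degreeOf_le_iff.mp h s (mem_support_iff.mpr (by simpa using hs))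
    lia

/-- One elimination step: it cancels the term of degree `d + j` in `v` of `f` by means of a
polynomial `g` of degree `d` in `v`. -/
noncomputable def elimStep (v : Deriv n) (d : ℕ) (g : DiffPoly F n) (j : ℕ) (f : DiffPoly F n) :
    DiffPoly F n :=
  coeffAt v d g * f - coeffAt v (d + j) f * (X v ^ j * g)

/-- The two terms of degree `d + j` in `v` cancel, so `f` and `g` may be replaced by their
truncations `f'` and `g'` below the leading power. The coefficients that multiply them are free of
`v`. -/
theorem degreeOf_elimStep_lt {v : Deriv n} {d j : ℕ} {f g : DiffPoly F n} (hd : 0 < d)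
    (hg : g.degreeOf v = d) (hf : f.degreeOf v ≤ d + j) :
    (elimStep v d g j f).degreeOf v < d + j := by
  set f' := f - coeffAt v (d + j) f * X v ^ (d + j) with hf'
  set g' := g - coeffAt v d g * X v ^ d with hg'
  have h1 : f'.degreeOf v < d + j := degreeOf_sub_lead_lt (by lia) hf
  have h2 : g'.degreeOf v < d := degreeOf_sub_lead_lt hd hg.le
  have h3 : elimStep v d g j f = coeffAt v d g * f' - coeffAt v (d + j) f * (X v ^ j * g') := by
    rw [elimStep, hf', hg']
    ring
  rw [h3]
  refine (degreeOf_sub_le _ _ _).trans_lt (max_lt ?_ ?_)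
  · refine (degreeOf_mul_le _ _ _).trans_lt ?_
    rw [degreeOf_coeffAt_self, zero_add]
    exact h1
  · refine (degreeOf_mul_le _ _ _).trans_lt ?_
    rw [degreeOf_coeffAt_self, zero_add]
    refine (degreeOf_mul_le _ _ _).trans_lt ?_
    have := degreeOf_pow_le v (X v : DiffPoly F n) j
    rw [degreeOf_X_self, mul_one] at this
    lia

theorem degreeOf_elimStep_le {v w : Deriv n} {d j : ℕ} {f g : DiffPoly F n} (hw : w ∉ g.vars)
    (hvw : w ≠ v) : (elimStep v d g j f).degreeOf w ≤ f.degreeOf w := by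
  have hg : g.degreeOf w = 0 := by
    by_contra h
    exact hw (mem_vars_iff_degreeOf_ne_zero.mpr h)
  refine (degreeOf_sub_le _ _ _).trans (max_le ?_ ?_)
  · refine (degreeOf_mul_le _ _ _).trans ?_
    have := degreeOf_coeffAt_le v w d g
    lia
  · refine (degreeOf_mul_le _ _ _).trans ?_
    have h1 := degreeOf_coeffAt_le v w (d + j) f
    have h2 := degreeOf_mul_le w (X v ^ j) g
    have h3 := degreeOf_pow_le w (X v : DiffPoly F n) j
    rw [degreeOf_X_of_ne hvw, mul_zero] at h3
    lia

theorem vars_elimStep_subset {v : Deriv n} {d j : ℕ} {f g : DiffPoly F n} (hv : v ∈ g.vars) :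
    (elimStep v d g j f).vars ⊆ f.vars ∪ g.vars := by
  intro w hw
  by_contra h
  rw [Finset.mem_union, not_or] at h
  have hvw : w ≠ v := fun hvw => h.2 (hvw ▸ hv)
  have := degreeOf_elimStep_le (d := d) (j := j) (f := f) h.2 hvw
  have h1 := mem_vars_iff_degreeOf_ne_zero.mp hw
  exact h.1 (mem_vars_iff_degreeOf_ne_zero.mpr (by lia))

theorem totalDegree_coeffAt_mul_le {v : Deriv n} {d : ℕ} {f g : DiffPoly F n} :
    (coeffAt v d g * f).totalDegree ≤ f.totalDegree + (g.totalDegree - d) := by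
  refine (totalDegree_mul _ _).trans ?_
  have := totalDegree_coeffAt_le v d g
  lia

theorem totalDegree_coeffAt_mul_X_pow_mul_le {v : Deriv n} {d j : ℕ} {f g : DiffPoly F n} :
    (coeffAt v (d + j) f * (X v ^ j * g)).totalDegree ≤ f.totalDegree + (g.totalDegree - d) := by
  -- If `deg f < d + j`, the coefficient vanishes. Otherwise the truncated difference `deg f - (d +
  -- j)` is a true one, and `j` cancels against the degree of `v^j`.
  by_cases h : f.totalDegree < d + j
  · rw [coeffAt_eq_zero_of_lt h, zero_mul, totalDegree_zero]
    exact Nat.zero_le _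
  · refine (totalDegree_mul _ _).trans ?_
    have h1 := totalDegree_mul (X v ^ j) g
    rw [totalDegree_X_pow] at h1
    have := totalDegree_coeffAt_le v (d + j) f
    lia

theorem totalDegree_elimStep_le {v : Deriv n} {d j : ℕ} {f g : DiffPoly F n} :
    (elimStep v d g j f).totalDegree ≤ f.totalDegree + (g.totalDegree - d) :=
  (totalDegree_sub _ _).trans
    (max_le totalDegree_coeffAt_mul_le totalDegree_coeffAt_mul_X_pow_mul_le)

/-- The elimination steps for the degrees `d + j - 1, …, d` in `v`. -/
noncomputable def elimSteps (v : Deriv n) (d : ℕ) (g : DiffPoly F n) :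
    ℕ → DiffPoly F n → DiffPoly F n
  | 0, f => f
  | j + 1, f => elimSteps v d g j (elimStep v d g j f)

theorem exists_elimSteps_eq (v : Deriv n) (d : ℕ) (g : DiffPoly F n) (j : ℕ) (f : DiffPoly F n) :
    ∃ q, coeffAt v d g ^ j * f = q * g + elimSteps v d g j f := by
  induction j generalizing f with
  | zero => exact ⟨0, by simp [elimSteps]⟩
  | succ j ih =>
    obtain ⟨q, hq⟩ := ih (elimStep v d g j f)
    refine ⟨q + coeffAt v d g ^ j * (coeffAt v (d + j) f * X v ^ j), ?_⟩
    rw [elimSteps, add_mul, add_right_comm, ← hq, elimStep]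
    ring

theorem degreeOf_elimSteps_lt {v : Deriv n} {d j : ℕ} {f g : DiffPoly F n} (hd : 0 < d)
    (hg : g.degreeOf v = d) (hf : f.degreeOf v < d + j) :
    (elimSteps v d g j f).degreeOf v < d := by
  induction j generalizing f with
  | zero => exact hf
  | succ j ih => exact ih (degreeOf_elimStep_lt hd hg (by lia))

theorem degreeOf_elimSteps_le {v w : Deriv n} {d j : ℕ} {f g : DiffPoly F n} (hw : w ∉ g.vars)
    (hvw : w ≠ v) : (elimSteps v d g j f).degreeOf w ≤ f.degreeOf w := by
  induction j generalizing f with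
  | zero => exact le_rfl
  | succ j ih => exact ih.trans (degreeOf_elimStep_le hw hvw)

theorem vars_elimSteps_subset {v : Deriv n} {d j : ℕ} {f g : DiffPoly F n} (hv : v ∈ g.vars) :
    (elimSteps v d g j f).vars ⊆ f.vars ∪ g.vars := by
  induction j generalizing f with
  | zero => exact Finset.subset_union_left
  | succ j ih =>
    exact ih.trans (Finset.union_subset (vars_elimStep_subset hv) Finset.subset_union_right)

theorem totalDegree_elimSteps_le {v : Deriv n} {d j : ℕ} {f g : DiffPoly F n} :
    (elimSteps v d g j f).totalDegree ≤ f.totalDegree + j * (g.totalDegree - d) := by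
  induction j generalizing f with
  | zero => simp [elimSteps]
  | succ j ih =>
    have := totalDegree_elimStep_le (v := v) (d := d) (g := g) (j := j) (f := f)
    refine ih.trans ?_
    rw [add_mul]
    lia

/-- The pseudo-remainder of `f` by `g` with respect to `v`. -/
noncomputable def pseudoRem (v : Deriv n) (g f : DiffPoly F n) : DiffPoly F n :=
  elimSteps v (g.degreeOf v) g (f.degreeOf v + 1 - g.degreeOf v) f

theorem isPseudoRemainder_pseudoRem {v : Deriv n} {g : DiffPoly F n} (hv : v ∈ g.vars)
    (f : DiffPoly F n) : IsPseudoRemainder v g f (pseudoRem v g f) :=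
  ⟨exists_elimSteps_eq _ _ _ _ _, degreeOf_elimSteps_lt
    (Nat.pos_of_ne_zero (mem_vars_iff_degreeOf_ne_zero.mp hv)) rfl (by lia)⟩

/-- The exponent of the initial is prescribed, so two pseudo-remainders differ by a multiple of `g`.
A nonzero multiple has degree at least that of `g` in `v`. -/
theorem IsPseudoRemainder.unique {v : Deriv n} {g f r r' : DiffPoly F n}
    (h : IsPseudoRemainder v g f r) (h' : IsPseudoRemainder v g f r') : r = r' := by
  obtain ⟨⟨q, hq⟩, hr⟩ := h
  obtain ⟨⟨q', hq'⟩, hr'⟩ := h'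
  have key : (q - q') * g = r' - r := by
    rw [hq] at hq'
    linear_combination hq'
  have hlt : (r' - r).degreeOf v < g.degreeOf v :=
    (degreeOf_sub_le _ _ _).trans_lt (max_lt hr' hr)
  by_cases h0 : q - q' = 0
  · rw [h0, zero_mul] at key
    exact (sub_eq_zero.mp key.symm).symm
  · have hg : g ≠ 0 := by
      rintro rfl
      simp at hr
    rw [← key, degreeOf_mul_eq h0 hg] at hlt
    lia

/-- There are `deg_v f + 1 - d ≤ deg f` steps, as `d ≥ 1`, and each adds at most `m` to the degree.
Counting with `deg + 1` makes the bound multiplicative, so that it iterates. -/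
theorem totalDegree_pseudoRem_lt {v : Deriv n} {g f : DiffPoly F n} {m : ℕ} (hv : v ∈ g.vars)
    (hg : g.totalDegree ≤ m) :
    (pseudoRem v g f).totalDegree + 1 ≤ (m + 1) * (f.totalDegree + 1) := by
  have hd : 0 < g.degreeOf v := Nat.pos_of_ne_zero (mem_vars_iff_degreeOf_ne_zero.mp hv)
  have h1 := totalDegree_elimSteps_le (v := v) (d := g.degreeOf v)
    (j := f.degreeOf v + 1 - g.degreeOf v) (f := f) (g := g)
  have h2 := degreeOf_le_totalDegree f v
  have h3 : (f.degreeOf v + 1 - g.degreeOf v) * (g.totalDegree - g.degreeOf v) ≤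
      f.totalDegree * m := Nat.mul_le_mul (by lia) (by lia)
  change (elimSteps _ _ _ _ _).totalDegree + 1 ≤ _
  have h4 : (m + 1) * (f.totalDegree + 1) = f.totalDegree * m + f.totalDegree + m + 1 := by ring
  lia

/-- The last term of a pseudo-remainder sequence. -/
noncomputable def iterPseudoRem : List (Deriv n × DiffPoly F n) → DiffPoly F n → DiffPoly F n
  | [], f => f
  | a :: L, f => iterPseudoRem L (pseudoRem a.1 a.2 f)

theorem isIterated_iterPseudoRem {L : List (Deriv n × DiffPoly F n)}
    (hL : ∀ a ∈ L, a.1 ∈ a.2.vars) (f : DiffPoly F n) :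
    IsIteratedPseudoRemainder L f (iterPseudoRem L f) := by
  induction L generalizing f with
  | nil => exact .nil f
  | cons a L ih =>
    exact .cons a.1 a.2 L f _ _ (isPseudoRemainder_pseudoRem (hL a List.mem_cons_self) f)
      (ih (fun b hb => hL b (List.mem_cons_of_mem _ hb)) _)

theorem IsIteratedPseudoRemainder.unique {L : List (Deriv n × DiffPoly F n)}
    {f r r' : DiffPoly F n} (h : IsIteratedPseudoRemainder L f r)
    (h' : IsIteratedPseudoRemainder L f r') : r = r' := by
  induction h with
  | nil f => cases h'; rfl
  | cons v g L f f' r h1 _ ih =>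
    cases h' with
    | cons _ _ _ _ f'' _ h2 h3 =>
      obtain rfl := h1.unique h2
      exact ih h3

theorem vars_iterPseudoRem_subset {L : List (Deriv n × DiffPoly F n)} {V : Set (Deriv n)}
    (hL : ∀ a ∈ L, a.1 ∈ a.2.vars ∧ ∀ w ∈ a.2.vars, w ∈ V) {f : DiffPoly F n}
    (hf : ∀ w ∈ f.vars, w ∈ V) : ∀ w ∈ (iterPseudoRem L f).vars, w ∈ V := by
  induction L generalizing f with
  | nil => exact hf
  | cons a L ih =>
    refine ih (fun b hb => hL b (List.mem_cons_of_mem _ hb)) fun w hw => ?_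
    obtain ⟨h1, h2⟩ := hL a List.mem_cons_self
    rcases Finset.mem_union.mp (vars_elimSteps_subset h1 hw) with h | h
    exacts [hf w h, h2 w h]

theorem totalDegree_iterPseudoRem_lt {L : List (Deriv n × DiffPoly F n)} {m : ℕ}
    (hL : ∀ a ∈ L, a.1 ∈ a.2.vars ∧ a.2.totalDegree ≤ m) (f : DiffPoly F n) :
    (iterPseudoRem L f).totalDegree + 1 ≤ (m + 1) ^ L.length * (f.totalDegree + 1) := by
  induction L generalizing f with
  | nil => simp [iterPseudoRem]
  | cons a L ih =>
    obtain ⟨h1, h2⟩ := hL a List.mem_cons_self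
    refine (ih (fun b hb => hL b (List.mem_cons_of_mem _ hb)) _).trans ?_
    rw [List.length_cons, pow_succ, mul_assoc]
    exact Nat.mul_le_mul_left _ (totalDegree_pseudoRem_lt h1 h2)

theorem degreeOf_iterPseudoRem_le {L : List (Deriv n × DiffPoly F n)} {w : Deriv n}
    (hL : ∀ a ∈ L, w ≠ a.1 ∧ w ∉ a.2.vars) (f : DiffPoly F n) :
    (iterPseudoRem L f).degreeOf w ≤ f.degreeOf w := by
  induction L generalizing f with
  | nil => exact le_rfl
  | cons a L ih =>
    obtain ⟨h1, h2⟩ := hL a List.mem_cons_self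
    exact (ih (fun b hb => hL b (List.mem_cons_of_mem _ hb)) _).trans
      (degreeOf_elimSteps_le h2 h1)

/-- Each division lowers the degree in its own variable. Later divisors do not contain that
variable, so they cannot raise its degree again. -/
theorem degreeOf_iterPseudoRem_lt {L : List (Deriv n × DiffPoly F n)}
    (hL : ∀ a ∈ L, a.1 ∈ a.2.vars)
    (hP : L.Pairwise fun a b => a.1 ≠ b.1 ∧ a.1 ∉ b.2.vars) (f : DiffPoly F n) :
    ∀ a ∈ L, (iterPseudoRem L f).degreeOf a.1 < a.2.degreeOf a.1 := by
  induction L generalizing f with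
  | nil => simp
  | cons b L ih =>
    rw [List.pairwise_cons] at hP
    intro a ha
    rcases List.mem_cons.mp ha with rfl | ha
    · exact (degreeOf_iterPseudoRem_le hP.1 _).trans_lt
        (isPseudoRemainder_pseudoRem (hL a List.mem_cons_self) f).2
    · exact ih (fun b hb => hL b (List.mem_cons_of_mem _ hb)) hP.2 _ a ha

theorem coeffAt_mul_X_add {w : Deriv n} {S T : DiffPoly F n} (hS : w ∉ S.vars)
    (hT : w ∉ T.vars) : coeffAt w 1 (S * X w + T) = S := by
  have key : ∀ {P : DiffPoly F n}, w ∉ P.vars → ∀ s : Mon n, s w ≠ 0 → P.coeff s = 0 := by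
    intro P hP s hs
    by_contra h
    exact hP (mem_vars_iff_mem_support w |>.mpr
      ⟨s, mem_support_iff.mpr h, Finsupp.mem_support_iff.mpr hs⟩)
  ext t
  rw [coeff_coeffAt]
  split_ifs with h
  · rw [coeff_add, coeff_mul_X, key hT _ (by simp), add_zero]
  · exact (key hS _ h).symm

theorem degreeOf_mul_X_add {w : Deriv n} {S T : DiffPoly F n} (hS : w ∉ S.vars)
    (hT : w ∉ T.vars) (h0 : S ≠ 0) : (S * X w + T).degreeOf w = 1 := by
  have hS' : S.degreeOf w = 0 := by
    by_contra h
    exact hS (mem_vars_iff_degreeOf_ne_zero.mpr h)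
  have hT' : T.degreeOf w = 0 := by
    by_contra h
    exact hT (mem_vars_iff_degreeOf_ne_zero.mpr h)
  have h1 : (S * X w).degreeOf w = 1 := by
    rw [degreeOf_mul_eq h0 (X_ne_zero w), hS', degreeOf_X_self]
  rw [degreeOf_add_eq_of_degreeOf_lt (by lia), h1]

end Algebra

/-! ### The derivation: variables and degrees -/

section Derivation

open MvPolynomial

variable {F : Type*} [Field F] [Differential F] {n : ℕ}

omit [Differential F] in
theorem derivation_sum_apply {ι : Type*} (V : Finset ι)
    (d : ι → Derivation F (DiffPoly F n) (DiffPoly F n)) (f : DiffPoly F n) :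
    (∑ v ∈ V, d v) f = ∑ v ∈ V, d v f :=
  map_sum ((Pi.evalAddMonoidHom (fun _ : DiffPoly F n => DiffPoly F n) f).comp
    Derivation.coeFnAddMonoidHom) d V

/-- The set `V` may exceed the variables of `f`, so that one finite sum serves for all instances in
the cost analysis. -/
theorem δ_eq (f : DiffPoly F n) {V : Finset (Deriv n)} (hV : f.vars ⊆ V) :
    δ f = coeffDeriv f + ∑ v ∈ V, X (v.1, v.2 + 1) * pderiv v f := by
  classical
  have h : δ f = coeffDeriv f + mkDerivation F
        (fun v : Deriv n => (X (v.1, v.2 + 1) : DiffPoly F n)) f := rfl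
  rw [h]
  congr 1
  have : mkDerivation F (fun v : Deriv n => (X (v.1, v.2 + 1) : DiffPoly F n)) f =
      (∑ v ∈ V, (X (v.1, v.2 + 1) : DiffPoly F n) • pderiv v) f := by
    refine derivation_eq_of_forall_mem_vars fun i hi => ?_
    rw [mkDerivation_X, derivation_sum_apply,
      Finset.sum_eq_single_of_mem i (hV hi)]
    · simp
    · intro b _ hb
      simp [pderiv_X_of_ne hb.symm]
  rw [this, derivation_sum_apply]
  rfl

theorem support_coeffDeriv_subset (f : DiffPoly F n) : (coeffDeriv f).support ⊆ f.support := by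
  intro s
  rw [mem_support_iff, mem_support_iff, coeff_coeffDeriv]
  contrapose!
  intro h
  rw [h, map_zero]

omit [Differential F] in
theorem vars_subset_of_support_subset {f g : DiffPoly F n} (h : f.support ⊆ g.support) :
    f.vars ⊆ g.vars := by
  intro w
  rw [mem_vars_iff_mem_support, mem_vars_iff_mem_support]
  exact fun ⟨d, hd, hw⟩ => ⟨d, h hd, hw⟩

theorem vars_coeffDeriv_subset (f : DiffPoly F n) : (coeffDeriv f).vars ⊆ f.vars :=
  vars_subset_of_support_subset (support_coeffDeriv_subset f)

omit [Differential F] in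
theorem mem_support_pderiv {v : Deriv n} {f : DiffPoly F n} {s : Mon n}
    (hs : s ∈ (pderiv v f).support) : s + Finsupp.single v 1 ∈ f.support := by
  rw [mem_support_iff, coeff_pderiv] at hs
  exact mem_support_iff.mpr (left_ne_zero_of_mul hs)

omit [Differential F] in
theorem vars_pderiv_subset (v : Deriv n) (f : DiffPoly F n) : (pderiv v f).vars ⊆ f.vars := by
  intro w
  rw [mem_vars_iff_mem_support, mem_vars_iff_mem_support]
  rintro ⟨d, hd, hw⟩
  refine ⟨_, mem_support_pderiv hd, ?_⟩
  rw [Finsupp.mem_support_iff] at hw ⊢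
  simp [hw]

omit [Differential F] in
theorem totalDegree_X_mul_pderiv_le (v w : Deriv n) (f : DiffPoly F n) :
    (X w * pderiv v f).totalDegree ≤ f.totalDegree := by
  by_cases h0 : pderiv v f = 0
  · simp [h0]
  -- Every monomial of the partial derivative comes from one of `f` by removing a factor `v`; the
  -- factor `X w` only restores the lost degree.
  have h1 : (pderiv v f).totalDegree + 1 ≤ f.totalDegree := by
    obtain ⟨s, hs, hs'⟩ := Finset.exists_mem_eq_sup _ (support_nonempty.mpr h0)
      (fun s : Mon n => s.sum fun _ e => e)
    have h2 := le_totalDegree (mem_support_pderiv hs)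
    rw [Finsupp.sum_add_index' (by simp) (by simp), Finsupp.sum_single_index rfl] at h2
    rw [totalDegree, hs']
    exact h2
  refine (totalDegree_mul _ _).trans ?_
  rw [totalDegree_X]
  lia

theorem totalDegree_δ_le (f : DiffPoly F n) : (δ f).totalDegree ≤ f.totalDegree := by
  rw [δ_eq f (Finset.Subset.refl _)]
  refine (totalDegree_add _ _).trans (max_le ?_ ?_)
  · exact totalDegree_le_of_support_subset (support_coeffDeriv_subset f)
  · exact totalDegree_finsetSum_le fun v _ => totalDegree_X_mul_pderiv_le _ _ _

theorem mem_vars_δ {f : DiffPoly F n} {w : Deriv n} (hw : w ∈ (δ f).vars) :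
    w ∈ f.vars ∨ ∃ v ∈ f.vars, w = (v.1, v.2 + 1) := by
  classical
  rw [δ_eq f (Finset.Subset.refl _)] at hw
  rcases Finset.mem_union.mp (vars_add_subset _ _ hw) with h | h
  · exact .inl (vars_coeffDeriv_subset f h)
  · obtain ⟨v, hv, h⟩ := Finset.mem_biUnion.mp (vars_sum_subset _ _ h)
    rcases Finset.mem_union.mp (vars_mul _ _ h) with h | h
    · rw [vars_X, Finset.mem_singleton] at h
      exact .inr ⟨v, hv, h⟩
    · exact .inl (vars_pderiv_subset v f h)

theorem totalDegree_iterate_δ_le (f : DiffPoly F n) (k : ℕ) :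
    (δ^[k] f).totalDegree ≤ f.totalDegree := by
  induction k with
  | zero => exact le_rfl
  | succ k ih =>
    rw [Function.iterate_succ_apply']
    exact (totalDegree_δ_le _).trans ih

theorem mem_vars_iterate_δ {f : DiffPoly F n} {k : ℕ} {w : Deriv n}
    (hw : w ∈ (δ^[k] f).vars) : ∃ v ∈ f.vars, ∃ j ≤ k, w = (v.1, v.2 + j) := by
  induction k generalizing w with
  | zero => exact ⟨w, hw, 0, le_rfl, rfl⟩
  | succ k ih =>
    rw [Function.iterate_succ_apply'] at hw
    rcases mem_vars_δ hw with h | ⟨w, h, rfl⟩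
    · obtain ⟨v, hv, j, hj, rfl⟩ := ih h
      exact ⟨v, hv, j, by lia, rfl⟩
    · obtain ⟨v, hv, j, hj, rfl⟩ := ih h
      exact ⟨v, hv, j + 1, by lia, rfl⟩

end Derivation

/-! ### Leaders of derivatives and auto-reduced sets -/

section Rankings

open MvPolynomial

variable {F : Type*} [Field F] {n p : ℕ} {R : Ranking n}

/-- The `k`-th derivative of `v`. -/
abbrev shift (v : Deriv n) (k : ℕ) : Deriv n := (v.1, v.2 + k)

theorem Ranking.IsLeader.unique {f : DiffPoly F n} {v w : Deriv n} (hv : R.IsLeader f v)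
    (hw : R.IsLeader f w) : v = w := by
  by_contra h
  exact R.irrefl _ (R.trans _ _ _ (hw.2 v hv.1 h) (hv.2 w hw.1 (Ne.symm h)))

theorem Ranking.lt_shift_succ (v : Deriv n) (k : ℕ) : R.lt v (shift v (k + 1)) := by
  induction k with
  | zero => exact R.lt_deriv v
  | succ k ih => exact R.trans _ _ _ ih (R.lt_deriv _)

theorem Ranking.eq_or_lt_shift (v : Deriv n) (k : ℕ) :
    v = shift v k ∨ R.lt v (shift v k) := by
  cases k with
  | zero => exact .inl rfl
  | succ k => exact .inr (R.lt_shift_succ v k)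

/-- If two leaders belonged to the same indeterminate, one would be a proper derivative of the
other, or they would coincide. The first is excluded by reducedness; in the second case each
polynomial would have smaller degree than the other in the common leader. -/
theorem Ranking.IsAutoReduced.injective_fst {A : Fin p → DiffPoly F n} {u : Fin p → Deriv n}
    (hA : R.IsAutoReduced A) (hu : ∀ i, R.IsLeader (A i) (u i)) :
    Function.Injective fun i => (u i).1 := by
  have key : ∀ i j, i ≠ j → (u i).1 = (u j).1 → (u i).2 < (u j).2 → False := by
    intro i j hij h h2
    refine (hA.2 j i hij.symm (u i) (hu i)).1 ((u j).2 - (u i).2) (by lia) ?_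
    rw [h, Nat.add_sub_cancel' h2.le]
    exact (hu j).1
  intro i j h
  by_contra hij
  rcases lt_trichotomy (u i).2 (u j).2 with h2 | h2 | h2
  · exact key i j hij h h2
  · have huu : u i = u j := Prod.ext h h2
    have h3 := (hA.2 j i (Ne.symm hij) (u i) (hu i)).2
    have h4 := (hA.2 i j hij (u j) (hu j)).2
    rw [huu] at h3
    exact absurd h3 h4.not_gt
  · exact key j i (Ne.symm hij) h.symm h2

theorem separant_ne_zero [CharZero F] {f : DiffPoly F n} {v : Deriv n} (hv : v ∈ f.vars) :
    separant v f ≠ 0 := by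
  classical
  obtain ⟨s, hs, hsv⟩ := (mem_vars_iff_mem_support v).mp hv
  intro h
  have h1 := coeff_pderiv (i := v) f (s - Finsupp.single v 1)
  have h2 : Finsupp.single v 1 ≤ s := by
    rw [Finsupp.single_le_iff]
    exact Nat.one_le_iff_ne_zero.mpr (Finsupp.mem_support_iff.mp hsv)
  rw [tsub_add_cancel_of_le h2] at h1
  change pderiv v f = 0 at h
  rw [h, coeff_zero] at h1
  exact mul_ne_zero (mem_support_iff.mp hs) (Nat.cast_add_one_ne_zero _) h1.symm

theorem Ranking.IsLeader.eq_or_lt {f : DiffPoly F n} {v w : Deriv n} (hv : R.IsLeader f v)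
    (hw : w ∈ f.vars) : w = v ∨ R.lt w v := by
  by_cases h : w = v
  exacts [.inl h, .inr (hv.2 w hw h)]

theorem Ranking.IsLeader.vars_separant_lt {f : DiffPoly F n} {v w : Deriv n}
    (hv : R.IsLeader f v) (k : ℕ) (hw : w ∈ (separant v f).vars) :
    R.lt w (shift v (k + 1)) := by
  rcases hv.eq_or_lt (vars_pderiv_subset v f hw) with rfl | h
  · exact R.lt_shift_succ _ _
  · exact R.trans _ _ _ h (R.lt_shift_succ _ _)

variable [Differential F]

/-- In the first derivative the chain rule produces the term `separant v f * X (shift v 1)`.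
Deriving once more shifts that variable and leaves the coefficient; all other terms stay below the
new leader since rankings are compatible with derivation. -/
theorem Ranking.IsLeader.exists_iterate_δ_eq {f : DiffPoly F n} {v : Deriv n}
    (hv : R.IsLeader f v) (k : ℕ) :
    ∃ T : DiffPoly F n, δ^[k + 1] f = separant v f * X (shift v (k + 1)) + T ∧
      ∀ w ∈ T.vars, R.lt w (shift v (k + 1)) := by
  classical
  induction k with
  | zero =>
    refine ⟨coeffDeriv f + ∑ w ∈ f.vars.erase v, X (shift w 1) * pderiv w f, ?_, ?_⟩
    · rw [Function.iterate_one, δ_eq f (Finset.Subset.refl _),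
        ← Finset.add_sum_erase _ _ hv.1, separant]
      ring
    · intro w hw
      have hf : ∀ w ∈ f.vars, R.lt w (shift v 1) := fun w hw => by
        rcases hv.eq_or_lt hw with rfl | h
        · exact R.lt_deriv _
        · exact R.trans _ _ _ h (R.lt_deriv _)
      rcases Finset.mem_union.mp (vars_add_subset _ _ hw) with h | h
      · exact hf w (vars_coeffDeriv_subset f h)
      · obtain ⟨z, hz, h⟩ := Finset.mem_biUnion.mp (vars_sum_subset _ _ h)
        rw [Finset.mem_erase] at hz
        rcases Finset.mem_union.mp (vars_mul _ _ h) with h | h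
        · rw [vars_X, Finset.mem_singleton] at h
          rw [h]
          exact R.deriv_lt_deriv _ _ (hv.2 z hz.2 hz.1)
        · exact hf w (vars_pderiv_subset z f h)
  | succ k ih =>
    obtain ⟨T, hT, hT'⟩ := ih
    refine ⟨X (shift v (k + 1)) * δ (separant v f) + δ T, ?_, ?_⟩
    · rw [Function.iterate_succ_apply', hT, map_add, Derivation.leibniz, δ_X, smul_eq_mul,
        smul_eq_mul, add_assoc]
      rfl
    · intro w hw
      have hlt : R.lt (shift v (k + 1)) (shift v (k + 1 + 1)) := R.lt_deriv _
      have hδ : ∀ P : DiffPoly F n, (∀ w ∈ P.vars, R.lt w (shift v (k + 1))) →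
          ∀ w ∈ (δ P).vars, R.lt w (shift v (k + 1 + 1)) := by
        intro P hP w hw
        rcases mem_vars_δ hw with h | ⟨z, hz, rfl⟩
        · exact R.trans _ _ _ (hP w h) hlt
        · exact R.deriv_lt_deriv _ _ (hP z hz)
      rcases Finset.mem_union.mp (vars_add_subset _ _ hw) with h | h
      · rcases Finset.mem_union.mp (vars_mul _ _ h) with h | h
        · rw [vars_X, Finset.mem_singleton] at h
          rw [h]
          exact hlt
        · exact hδ _ (fun w hw => hv.vars_separant_lt k hw) w h
      · exact hδ T hT' w h

theorem Ranking.IsLeader.eq_or_lt_of_mem_vars_iterate_δ {f : DiffPoly F n} {v w : Deriv n}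
    (hv : R.IsLeader f v) {k : ℕ} (hw : w ∈ (δ^[k] f).vars) :
    w = shift v k ∨ R.lt w (shift v k) := by
  classical
  cases k with
  | zero => exact hv.eq_or_lt hw
  | succ k =>
    obtain ⟨T, hT, hT'⟩ := hv.exists_iterate_δ_eq k
    rw [hT] at hw
    rcases Finset.mem_union.mp (vars_add_subset _ _ hw) with h | h
    · rcases Finset.mem_union.mp (vars_mul _ _ h) with h | h
      · exact .inr (hv.vars_separant_lt k h)
      · rw [vars_X, Finset.mem_singleton] at h
        exact .inl h
    · exact .inr (hT' w h)

theorem Ranking.IsLeader.degreeOf_iterate_δ [CharZero F] {f : DiffPoly F n} {v : Deriv n}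
    (hv : R.IsLeader f v) (k : ℕ) : (δ^[k + 1] f).degreeOf (shift v (k + 1)) = 1 := by
  obtain ⟨T, hT, hT'⟩ := hv.exists_iterate_δ_eq k
  rw [hT]
  exact degreeOf_mul_X_add (fun h => R.irrefl _ (hv.vars_separant_lt k h))
    (fun h => R.irrefl _ (hT' _ h)) (separant_ne_zero hv.1)

theorem Ranking.IsLeader.initial_iterate_δ [CharZero F] {f : DiffPoly F n} {v : Deriv n}
    (hv : R.IsLeader f v) (k : ℕ) :
    initial (shift v (k + 1)) (δ^[k + 1] f) = separant v f := by
  rw [initial_eq_coeffAt, hv.degreeOf_iterate_δ k]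
  obtain ⟨T, hT, hT'⟩ := hv.exists_iterate_δ_eq k
  rw [hT]
  exact coeffAt_mul_X_add (fun h => R.irrefl _ (hv.vars_separant_lt k h))
    (fun h => R.irrefl _ (hT' _ h))

theorem Ranking.IsLeader.shift_mem_vars_iterate_δ [CharZero F] {f : DiffPoly F n} {v : Deriv n}
    (hv : R.IsLeader f v) (k : ℕ) : shift v k ∈ (δ^[k] f).vars := by
  cases k with
  | zero => exact hv.1
  | succ k =>
    rw [mem_vars_iff_degreeOf_ne_zero, hv.degreeOf_iterate_δ k]
    exact one_ne_zero

end Rankings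

/-! ### The differential remainder: order of reduction, congruence, reducedness -/

section Remainder

open MvPolynomial

variable {n p : ℕ}

/-- `a` precedes `b` in the order of decreasing leaders of `δ ^ a.2 (A a.1)`. -/
def Ranking.Precedes (R : Ranking n) (u : Fin p → Deriv n) (a b : Fin p × ℕ) : Prop :=
  R.lt (shift (u b.1) b.2) (shift (u a.1) a.2)

theorem Ranking.exists_reductionList (R : Ranking n) {u : Fin p → Deriv n}
    (hu : Function.Injective fun i => (u i).1) (h : ℕ) :
    ∃ L : List (Fin p × ℕ), (∀ i k, (i, k) ∈ L ↔ k ≤ h) ∧ L.Pairwise (R.Precedes u) ∧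
      L.length = p * (h + 1) := by
  classical
  set S : Finset (Fin p × ℕ) := Finset.univ ×ˢ Finset.range (h + 1) with hS
  -- Sorting needs a total relation, hence the reflexive closure. Since the list has no duplicates,
  -- the sorted list is strictly ordered.
  let r : Fin p × ℕ → Fin p × ℕ → Prop := fun a b => a = b ∨ R.Precedes u a b
  have hinj : ∀ a b : Fin p × ℕ, shift (u a.1) a.2 = shift (u b.1) b.2 → a = b := by
    intro a b hab
    have h1 : a.1 = b.1 := hu (congrArg Prod.fst hab :)
    have h2 := congrArg Prod.snd hab
    refine Prod.ext h1 ?_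
    simp only [h1] at h2
    exact Nat.add_left_cancel h2
  have : Std.Total r := ⟨fun a b => by
    rcases R.total (shift (u a.1) a.2) (shift (u b.1) b.2) with h | h | h
    exacts [.inr (.inr h), .inl (.inl (hinj a b h)), .inl (.inr h)]⟩
  have : IsTrans _ r := ⟨fun a b c => by
    rintro (rfl | h1) (rfl | h2)
    exacts [.inl rfl, .inr h2, .inr h1, .inr (R.trans _ _ _ h2 h1)]⟩
  refine ⟨S.toList.insertionSort r, ?_, ?_, ?_⟩
  · intro i k
    rw [List.mem_insertionSort, Finset.mem_toList, hS]
    simp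
  · have h1 := List.pairwise_insertionSort r S.toList
    have h2 : (S.toList.insertionSort r).Nodup :=
      (List.perm_insertionSort r _).nodup_iff.mpr (Finset.nodup_toList S)
    exact (h1.and h2).imp fun h => h.1.resolve_left h.2
  · rw [List.length_insertionSort, Finset.length_toList, hS]
    simp

theorem Ranking.reductionList_unique (R : Ranking n) {u : Fin p → Deriv n} {h : ℕ}
    {L L' : List (Fin p × ℕ)} (hL : ∀ i k, (i, k) ∈ L ↔ k ≤ h) (hP : L.Pairwise (R.Precedes u))
    (hL' : ∀ i k, (i, k) ∈ L' ↔ k ≤ h) (hP' : L'.Pairwise (R.Precedes u)) : L = L' := by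
  have hne : ∀ {a b}, R.Precedes u a b → a ≠ b := by
    rintro a _ h rfl
    exact R.irrefl _ h
  refine List.Perm.eq_of_pairwise (le := R.Precedes u)
    (fun a b _ _ h1 h2 => absurd (R.trans _ _ _ h1 h2) (R.irrefl _)) hP hP' ?_
  rw [List.perm_ext_iff_of_nodup]
  · rintro ⟨i, k⟩
    rw [hL, hL']
  · exact hP.imp hne
  · exact hP'.imp hne

variable {F : Type*} [Field F] [Differential F]

/-- The list of the polynomials that are used in a reduction, with their leaders. -/
noncomputable def reducers (u : Fin p → Deriv n) (A : Fin p → DiffPoly F n)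
    (L : List (Fin p × ℕ)) : List (Deriv n × DiffPoly F n) :=
  L.map fun a => (shift (u a.1) a.2, δ^[a.2] (A a.1))

variable {R : Ranking n} {u : Fin p → Deriv n} {A : Fin p → DiffPoly F n} {f r : DiffPoly F n}

theorem Ranking.IsDifferentialRemainder.unique {r' : DiffPoly F n}
    (h : R.IsDifferentialRemainder A f r) (h' : R.IsDifferentialRemainder A f r') : r' = r := by
  obtain ⟨u, L, hu, hL, hP, hr⟩ := h
  obtain ⟨u', L', hu', hL', hP', hr'⟩ := h'
  obtain rfl : u = u' := funext fun i => (hu i).unique (hu' i)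
  obtain rfl := R.reductionList_unique hL hP hL' hP'
  exact hr'.unique hr

theorem iterate_δ_mem_diffIdeal (A : Fin p → DiffPoly F n) (i : Fin p) (k : ℕ) :
    δ^[k] (A i) ∈ diffIdeal A := Ideal.subset_span ⟨i, k, rfl⟩

omit [Differential F] in
theorem prod_pow_pi_single (g : Fin p → DiffPoly F n) (i : Fin p) (l : ℕ) :
    ∏ j, g j ^ (Pi.single i l : Fin p → ℕ) j = g i ^ l := by
  rw [Finset.prod_eq_single i (fun j _ hj => by rw [Pi.single_eq_of_ne hj, pow_zero])
    (by simp), Pi.single_eq_same]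

/-- A division by `A_i` itself contributes a power of its initial, one by a proper derivative a
power of its separant. The exponents add up along the list. -/
theorem exists_prod_mul_sub_mem [CharZero F] (hu : ∀ i, R.IsLeader (A i) (u i))
    {L : List (Fin p × ℕ)} (hr : IsIteratedPseudoRemainder (reducers u A L) f r) :
    ∃ a b : Fin p → ℕ,
      (∏ i, separant (u i) (A i) ^ a i * initial (u i) (A i) ^ b i) * f - r ∈ diffIdeal A := by
  classical
  induction L generalizing f with
  | nil =>
    cases hr
    exact ⟨0, 0, by simp⟩
  | cons c L ih =>
    obtain ⟨i, k⟩ := c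
    rw [reducers, List.map_cons] at hr
    cases hr with
    | cons _ _ _ _ f' _ h h' =>
    obtain ⟨a, b, hab⟩ := ih h'
    obtain ⟨⟨q, hq⟩, -⟩ := h
    set l := f.degreeOf (shift (u i) k) + 1 - (δ^[k] (A i)).degreeOf (shift (u i) k)
    have h1 : initial (shift (u i) k) (δ^[k] (A i)) ^ l * f - f' ∈ diffIdeal A := by
      have : initial (shift (u i) k) (δ^[k] (A i)) ^ l * f - f' = q * δ^[k] (A i) := by
        rw [sub_eq_iff_eq_add]
        exact hq
      rw [this]
      exact Ideal.mul_mem_left _ _ (iterate_δ_mem_diffIdeal A i k)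
    set H := ∏ i, separant (u i) (A i) ^ a i * initial (u i) (A i) ^ b i with hH
    have h2 : H * (initial (shift (u i) k) (δ^[k] (A i)) ^ l) * f - r ∈ diffIdeal A := by
      have := (diffIdeal A).add_mem (Ideal.mul_mem_left _ H h1) hab
      convert this using 1
      ring
    cases k with
    | zero =>
      refine ⟨a, b + Pi.single i l, ?_⟩
      convert h2 using 3
      rw [hH]
      simp only [Pi.add_apply, pow_add, Finset.prod_mul_distrib, prod_pow_pi_single, mul_assoc]
      rfl
    | succ k =>
      refine ⟨a + Pi.single i l, b, ?_⟩
      convert h2 using 3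
      rw [hH, (hu i).initial_iterate_δ k]
      simp only [Pi.add_apply, pow_add, Finset.prod_mul_distrib, prod_pow_pi_single]
      ring

theorem mem_reducers_vars [CharZero F] (hu : ∀ i, R.IsLeader (A i) (u i))
    {L : List (Fin p × ℕ)} : ∀ a ∈ reducers u A L, a.1 ∈ a.2.vars := by
  intro a ha
  obtain ⟨⟨i, k⟩, -, rfl⟩ := List.mem_map.mp ha
  exact (hu i).shift_mem_vars_iterate_δ k

theorem pairwise_reducers (hu : ∀ i, R.IsLeader (A i) (u i)) {L : List (Fin p × ℕ)}
    (hP : L.Pairwise (R.Precedes u)) :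
    (reducers u A L).Pairwise fun a b => a.1 ≠ b.1 ∧ a.1 ∉ b.2.vars := by
  rw [reducers, List.pairwise_map]
  refine hP.imp fun {a b} h => ⟨fun hab => ?_, fun hab => ?_⟩
  · change shift (u a.1) a.2 = shift (u b.1) b.2 at hab
    rw [Ranking.Precedes, ← hab] at h
    exact R.irrefl _ h
  · rcases (hu b.1).eq_or_lt_of_mem_vars_iterate_δ hab with h1 | h1
    · rw [Ranking.Precedes, ← h1] at h
      exact R.irrefl _ h
    · exact R.irrefl _ (R.trans _ _ _ h h1)

omit [Differential F] in
theorem le_order {g : DiffPoly F n} {w : Deriv n} (hw : w ∈ g.vars) : w.2 ≤ order g :=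
  Finset.le_sup (f := Prod.snd) hw

/-- For `1 ≤ k ≤ order f` the divisor `δ^[k] (A i)` has degree 1 in its leader, so the remainder has
degree 0 there; `k = 0` gives the degree condition. For larger `k` an invariant on orders shows that
the variable never appears. -/
theorem isReduced_iterPseudoRem [CharZero F] (hA : R.IsAutoReduced A)
    (hu : ∀ i, R.IsLeader (A i) (u i)) {L : List (Fin p × ℕ)}
    (hL : ∀ i k, (i, k) ∈ L ↔ k ≤ order f) (hP : L.Pairwise (R.Precedes u)) (i : Fin p) :
    R.IsReduced (iterPseudoRem (reducers u A L) f) (A i) := by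
  intro v hv
  obtain rfl := (hu i).unique hv
  have hlt : ∀ k ≤ order f, (iterPseudoRem (reducers u A L) f).degreeOf (shift (u i) k) <
      (δ^[k] (A i)).degreeOf (shift (u i) k) := fun k hk =>
    degreeOf_iterPseudoRem_lt (mem_reducers_vars hu) (pairwise_reducers hu hP) f
      (shift (u i) k, δ^[k] (A i)) (List.mem_map.mpr ⟨(i, k), (hL i k).mpr hk, rfl⟩)
  refine ⟨fun k hk hmem => ?_, hlt 0 (Nat.zero_le _)⟩
  by_cases hkf : k ≤ order f
  · obtain ⟨k, rfl⟩ := Nat.exists_eq_add_of_le' hk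
    have := hlt _ hkf
    rw [(hu i).degreeOf_iterate_δ k] at this
    exact mem_vars_iff_degreeOf_ne_zero.mp hmem (by lia)
  -- The invariant: a derivative of the indeterminate of `u i` has order at most that of `u i` plus
  -- `order f`.
  · have key := vars_iterPseudoRem_subset (L := reducers u A L) (f := f)
      (V := {w | w.1 = (u i).1 → w.2 ≤ (u i).2 + order f}) ?_ ?_ _ hmem rfl
    · simp only at key
      lia
    · intro a ha
      refine ⟨mem_reducers_vars hu a ha, ?_⟩
      obtain ⟨⟨j, k'⟩, hjk, rfl⟩ := List.mem_map.mp ha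
      intro w hw hwi
      obtain ⟨z, hz, l, hl, rfl⟩ := mem_vars_iterate_δ hw
      have hk' := (hL _ _).mp hjk
      simp only at hwi hl ⊢
      -- For `j = i` this holds because `u i` is the leader and the ranking increases under
      -- derivation. For `j ≠ i` it holds because `A j` is reduced with respect to `A i`.
      suffices z.2 ≤ (u i).2 by lia
      by_cases hij : i = j
      · subst hij
        rcases (hu i).eq_or_lt hz with rfl | hz'
        · exact le_rfl
        · by_contra hcon
          rcases R.eq_or_lt_shift (u i) (z.2 - (u i).2) with h | h
          · have := congrArg Prod.snd h
            simp only at this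
            lia
          · rw [shift, ← hwi, Nat.add_sub_cancel' (by lia)] at h
            exact R.irrefl _ (R.trans _ _ _ h hz')
      · by_contra hcon
        refine (hA.2 j i (Ne.symm hij) (u i) (hu i)).1 (z.2 - (u i).2) (by lia) ?_
        rw [← hwi, Nat.add_sub_cancel' (by lia)]
        exact hz
    · intro w hw _
      have := le_order hw
      lia

theorem isDifferentialRemainder_iterPseudoRem [CharZero F]
    (hu : ∀ i, R.IsLeader (A i) (u i)) {L : List (Fin p × ℕ)}
    (hL : ∀ i k, (i, k) ∈ L ↔ k ≤ order f) (hP : L.Pairwise (R.Precedes u)) :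
    R.IsDifferentialRemainder A f (iterPseudoRem (reducers u A L) f) :=
  ⟨u, L, hu, hL, hP, isIterated_iterPseudoRem (mem_reducers_vars hu) f⟩

end Remainder

/-! ### A cost calculus for uniform computation trees -/

section Computation

universe w

variable {Ω : Type w} {F : Ω → Type u} [∀ ω, Field (F ω)] [∀ ω, Differential (F ω)] {I O : Type}

/-- From the values in `K`, available in inputs or registers, a tree can compute the values `goal`
with at most `c` operations, uniformly for all instances `ω ∈ P`. -/
def Solves (x : ∀ ω, I → F ω) (goal : O → ∀ ω, F ω) (P : Set Ω) (K : Set (∀ ω, F ω))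
    (c : ℕ) : Prop :=
  ∀ (loc : (∀ ω, F ω) → Operand I) (B : ℕ), (∀ κ ∈ K, ∀ k, loc κ = Sum.inr k → k < B) →
    ∃ T : CompTree I O, ∀ ω ∈ P, ∀ M : ℕ → F ω,
      (∀ κ ∈ K, Operand.val (x ω) M (loc κ) = κ ω) →
        (∀ o, (T.runFrom (x ω) M).1 o = goal o ω) ∧ (T.runFrom (x ω) M).2 ≤ c

/-- Every value in `V` agrees on `P` with one in `K`. -/
def Covers (P : Set Ω) (K V : Set (∀ ω, F ω)) : Prop :=
  ∀ κ ∈ V, ∃ κ' ∈ K, ∀ ω ∈ P, κ' ω = κ ω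

/-- A tree that has the values in `K` at its disposal can compute those in `V` with `c`
operations. -/
def Gets (x : ∀ ω, I → F ω) (goal : O → ∀ ω, F ω) (P : Set Ω) (K V : Set (∀ ω, F ω))
    (c : ℕ) : Prop :=
  ∀ K', K ⊆ K' → ∀ c', Solves x goal P (K' ∪ V) c' → Solves x goal P K' (c' + c)

variable {x : ∀ ω, I → F ω} {goal : O → ∀ ω, F ω} {P P' : Set Ω} {K K' V W : Set (∀ ω, F ω)}
  {c c' : ℕ}

omit [∀ ω, Field (F ω)] [∀ ω, Differential (F ω)] in
theorem covers_of_subset (h : V ⊆ K) : Covers P K V := fun κ hκ => ⟨κ, h hκ, fun _ _ => rfl⟩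

omit [∀ ω, Field (F ω)] [∀ ω, Differential (F ω)] in
theorem Covers.union (h : Covers P K V) : Covers P (K' ∪ K) (K' ∪ V) := by
  rintro κ (hκ | hκ)
  · exact ⟨κ, .inl hκ, fun _ _ => rfl⟩
  · obtain ⟨κ', h1, h2⟩ := h κ hκ
    exact ⟨κ', .inr h1, h2⟩

theorem Solves.mono_cost (h : Solves x goal P K c) (hc : c ≤ c') : Solves x goal P K c' := by
  intro loc B hB
  obtain ⟨T, hT⟩ := h loc B hB
  exact ⟨T, fun ω hω M hM => ⟨(hT ω hω M hM).1, (hT ω hω M hM).2.trans hc⟩⟩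

theorem Solves.mono_set (h : Solves x goal P K c) (hP : P' ⊆ P) : Solves x goal P' K c := by
  intro loc B hB
  obtain ⟨T, hT⟩ := h loc B hB
  exact ⟨T, fun ω hω => hT ω (hP hω)⟩

theorem Solves.of_covers (h : Solves x goal P V c) (hV : Covers P K V) :
    Solves x goal P K c := by
  classical
  intro loc B hB
  choose! g hg hg' using hV
  obtain ⟨T, hT⟩ := h (fun κ => loc (g κ)) B fun κ hκ k hk => hB _ (hg κ hκ) k hk
  exact ⟨T, fun ω hω M hM => hT ω hω M fun κ hκ => (hM _ (hg κ hκ)).trans (hg' κ hκ ω hω)⟩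

theorem Solves.mono (h : Solves x goal P V c) (hV : V ⊆ K) : Solves x goal P K c :=
  h.of_covers (covers_of_subset hV)

theorem Solves.halt (h : ∀ o, ∃ κ ∈ K, ∀ ω ∈ P, κ ω = goal o ω) : Solves x goal P K 0 := by
  intro loc B hB
  choose g hg hg' using h
  exact ⟨.halt fun o => loc (g o), fun ω hω M hM =>
    ⟨fun o => (hM _ (hg o)).trans (hg' o ω hω), le_rfl⟩⟩

theorem Solves.of_isEmpty (h : P = ∅) : Solves x goal P K c :=
  fun _ _ _ => ⟨.halt fun _ => Sum.inr 0, fun ω hω => by simp [h] at hω⟩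

theorem Solves.test {κ : ∀ ω, F ω} (hκ : κ ∈ K) (h₁ : Solves x goal (P ∩ {ω | κ ω = 0}) K c)
    (h₂ : Solves x goal (P ∩ {ω | κ ω ≠ 0}) K c) : Solves x goal P K (c + 1) := by
  intro loc B hB
  obtain ⟨T₁, hT₁⟩ := h₁ loc B hB
  obtain ⟨T₂, hT₂⟩ := h₂ loc B hB
  refine ⟨.ifZero (loc κ) T₁ T₂, fun ω hω M hM => ?_⟩
  rw [CompTree.runFrom, hM κ hκ]
  by_cases h : κ ω = 0
  · have := hT₁ ω ⟨hω, h⟩ M hM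
    simp only [if_pos h]
    exact ⟨this.1, by lia⟩
  · have := hT₂ ω ⟨hω, h⟩ M hM
    simp only [if_neg h]
    exact ⟨this.1, by lia⟩

/-- After zero tests of finitely many known values, one may assume that they vanish for the same
indices as in a fixed instance `ω₀`. -/
theorem Solves.tests {ι : Type*} (S : Finset ι) {a : ι → ∀ ω, F ω} (ha : ∀ i ∈ S, a i ∈ K)
    (h : ∀ ω₀ ∈ P, Solves x goal (P ∩ {ω | ∀ i ∈ S, a i ω = 0 ↔ a i ω₀ = 0}) K c) :
    Solves x goal P K (c + S.card) := by
  classical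
  induction S using Finset.induction_on generalizing P with
  | empty =>
    rcases P.eq_empty_or_nonempty with hP | ⟨ω₀, hω₀⟩
    · exact .of_isEmpty hP
    · simpa using h ω₀ hω₀
  | insert i S hi ih =>
    rw [Finset.card_insert_of_notMem hi, ← add_assoc]
    refine .test (ha i (Finset.mem_insert_self _ _)) ?_ ?_
    all_goals
      refine ih (fun j hj => ha j (Finset.mem_insert_of_mem hj)) fun ω₀ hω₀ =>
        (h ω₀ hω₀.1).mono_set ?_
      rintro ω ⟨⟨hω, h1⟩, h2⟩
      refine ⟨hω, fun j hj => ?_⟩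
      rcases Finset.mem_insert.mp hj with rfl | hj
      · have h3 := hω₀.2
        simp only [Set.mem_ofPred_eq] at h1 h3
        simp [h1, h3]
      · exact h2 j hj

theorem Gets.solves (h : Gets x goal P K V c) (h' : Solves x goal P (K ∪ V) c') :
    Solves x goal P K (c' + c) := h K le_rfl c' h'

theorem Gets.mono_cost (h : Gets x goal P K V c) (hc : c ≤ c') : Gets x goal P K V c' :=
  fun K' hK' c₁ h₁ => (h K' hK' c₁ h₁).mono_cost (by lia)

theorem Gets.of_covers (h : Gets x goal P K V c) (hW : Covers P V W) : Gets x goal P K W c :=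
  fun K' hK' c₁ h₁ => h K' hK' c₁ (h₁.of_covers hW.union)

theorem Covers.gets (h : Covers P K V) : Gets x goal P K V 0 := by
  intro K' hK' c₁ h₁
  refine h₁.of_covers ?_
  rintro κ (hκ | hκ)
  · exact ⟨κ, hκ, fun _ _ => rfl⟩
  · obtain ⟨κ', h1, h2⟩ := h κ hκ
    exact ⟨κ', hK' h1, h2⟩

theorem Gets.trans (h : Gets x goal P K V c) (h' : Gets x goal P (K ∪ V) W c') :
    Gets x goal P K W (c + c') := by
  intro K' hK' c₁ h₁
  have h2 := h' (K' ∪ V) (Set.union_subset_union_left _ hK') c₁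
    (h₁.mono (Set.union_subset_union_left _ Set.subset_union_left))
  exact (h K' hK' _ h2).mono_cost (by lia)

theorem Gets.union (h : Gets x goal P K V c) (h' : Gets x goal P K W c') :
    Gets x goal P K (V ∪ W) (c + c') := by
  intro K' hK' c₁ h₁
  rw [← Set.union_assoc] at h₁
  have h2 := h' (K' ∪ V) (hK'.trans Set.subset_union_left) c₁ h₁
  exact (h K' hK' _ h2).mono_cost (by lia)

theorem Gets.trans_union (h : Gets x goal P K V c) (h' : Gets x goal P (K ∪ V) W c') :
    Gets x goal P K (V ∪ W) (c + c') :=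
  h.trans (((covers_of_subset Set.subset_union_right).gets.union h').mono_cost (zero_add _).le)

theorem Gets.biUnion {ι : Type*} (S : Finset ι) {V : ι → Set (∀ ω, F ω)}
    (h : ∀ i ∈ S, Gets x goal P K (V i) c) :
    Gets x goal P K (⋃ i ∈ S, V i) (S.card * c) := by
  classical
  induction S using Finset.induction_on with
  | empty =>
    refine (Covers.gets ?_).mono_cost (Nat.zero_le _)
    simp [Covers]
  | insert i S hi ih =>
    rw [Finset.card_insert_of_notMem hi, Finset.set_biUnion_insert]
    refine ((h i (Finset.mem_insert_self _ _)).union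
      (ih fun j hj => h j (Finset.mem_insert_of_mem hj))).mono_cost (le_of_eq ?_)
    ring

/-- Known values lie in inputs or in registers below `B`, so register `B` can be overwritten safely.
The continuation is taken for locations updated at `κ`, with bound `B + 1`. -/
theorem Gets.of_store {κ : ∀ ω, F ω}
    (h : ∀ (loc : (∀ ω, F ω) → Operand I) (B : ℕ) (T : CompTree I O), ∃ T' : CompTree I O,
      ∀ ω, ∀ M : ℕ → F ω, (∀ κ ∈ K, Operand.val (x ω) M (loc κ) = κ ω) →
        T'.runFrom (x ω) M = ((T.runFrom (x ω) (Function.update M B (κ ω))).1,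
          (T.runFrom (x ω) (Function.update M B (κ ω))).2 + 1)) :
    Gets x goal P K {κ} 1 := by
  classical
  intro K' hK' c₁ h₁ loc B hB
  have hB' : ∀ κ' ∈ K' ∪ {κ}, ∀ k, Function.update loc κ (Sum.inr B) κ' = Sum.inr k →
      k < B + 1 := by
    intro κ' hκ' k hk
    by_cases heq : κ' = κ
    · subst heq
      rw [Function.update_self, Sum.inr.injEq] at hk
      lia
    · rw [Function.update_of_ne heq] at hk
      have := hB κ' (hκ'.resolve_right heq) k hk
      lia
  obtain ⟨T, hT⟩ := h₁ _ (B + 1) hB'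
  obtain ⟨T', hT'⟩ := h loc B T
  refine ⟨T', fun ω hω M hM => ?_⟩
  rw [hT' ω M fun κ hκ => hM κ (hK' hκ)]
  have hM' : ∀ κ' ∈ K' ∪ {κ}, Operand.val (x ω) (Function.update M B (κ ω))
      (Function.update loc κ (Sum.inr B) κ') = κ' ω := by
    intro κ' hκ'
    by_cases heq : κ' = κ
    · subst heq
      simp [Operand.val]
    · have hmem : κ' ∈ K' := hκ'.resolve_right heq
      rw [Function.update_of_ne heq, ← hM κ' hmem]
      cases hl : loc κ' with
      | inl i => rfl
      | inr k =>
        simp only [Operand.val]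
        rw [Function.update_of_ne (hB κ' hmem k hl).ne]
  obtain ⟨h2, h3⟩ := hT ω hω (Function.update M B (κ ω)) hM'
  exact ⟨h2, Nat.succ_le_succ h3⟩

theorem Gets.arith (op : ArithOp) {a b : ∀ ω, F ω} (ha : a ∈ K) (hb : b ∈ K) :
    Gets x goal P K {fun ω => op.eval (a ω) (b ω)} 1 :=
  .of_store fun loc B T => ⟨.arith op B (loc a) (loc b) T, fun ω M hM => by
    rw [CompTree.runFrom, hM a ha, hM b hb]⟩

theorem Gets.deriv {a : ∀ ω, F ω} (ha : a ∈ K) :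
    Gets x goal P K {fun ω => Differential.deriv (a ω)} 1 :=
  .of_store fun loc B T => ⟨.derive B (loc a) T, fun ω M hM => by
    rw [CompTree.runFrom, hM a ha]⟩

theorem Gets.sum {ι : Type*} (S : Finset ι) {a : ι → ∀ ω, F ω} (ha : ∀ i ∈ S, a i ∈ K)
    (h0 : (fun _ => 0) ∈ K) : Gets x goal P K {fun ω => ∑ i ∈ S, a i ω} S.card := by
  classical
  induction S using Finset.induction_on with
  | empty => exact (covers_of_subset (by simpa using h0)).gets
  | insert i S hi ih =>
    rw [Finset.card_insert_of_notMem hi]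
    refine (ih fun j hj => ha j (Finset.mem_insert_of_mem hj)).trans ?_
    have := Gets.arith (x := x) (goal := goal) (P := P)
      (K := K ∪ {fun ω => ∑ i ∈ S, a i ω}) .plus
      (.inl (ha i (Finset.mem_insert_self _ _))) (.inr rfl)
    simp only [Finset.sum_insert hi]
    exact this

theorem Gets.sum_mul {ι : Type*} (S : Finset ι) {a b : ι → ∀ ω, F ω} (ha : ∀ i ∈ S, a i ∈ K)
    (hb : ∀ i ∈ S, b i ∈ K) (h0 : (fun _ => 0) ∈ K) :
    Gets x goal P K {fun ω => ∑ i ∈ S, a i ω * b i ω} (2 * S.card) := by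
  have h1 : Gets x goal P K (⋃ i ∈ S, {fun ω => a i ω * b i ω}) (S.card * 1) :=
    .biUnion S fun i hi => .arith .times (ha i hi) (hb i hi)
  refine (h1.trans (.sum S (a := fun i ω => a i ω * b i ω) (fun i hi => .inr ?_)
    (.inl h0))).mono_cost (by lia)
  exact Set.mem_biUnion hi rfl

end Computation

/-! ### Cost of polynomial arithmetic within a box of monomials -/

section PolynomialArithmetic

open MvPolynomial

universe w

variable {Ω : Type w} {F : Ω → Type u} [∀ ω, Field (F ω)] {n : ℕ}

/-- The coefficients of a family of differential polynomials. -/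
def coeffs (g : ∀ ω, DiffPoly (F ω) n) : Set (∀ ω, F ω) :=
  Set.range fun (s : Mon n) ω => (g ω).coeff s

variable [∀ ω, Differential (F ω)] {I O : Type}
variable {x : ∀ ω, I → F ω} {goal : O → ∀ ω, F ω} {P : Set Ω} {K : Set (∀ ω, F ω)}
  {c : ℕ} {f g : ∀ ω, DiffPoly (F ω) n} {β : Mon n}

/-- Coefficients outside the box are zero, and zero is already available; only those in the box are
paid for. -/
theorem Gets.of_coeff (h0 : (fun _ => 0) ∈ K) (hg : ∀ ω ∈ P, (g ω).support ⊆ Finset.Iic β)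
    (h : ∀ s ∈ Finset.Iic β, Gets x goal P K {fun ω => (g ω).coeff s} c) :
    Gets x goal P K (coeffs g) ((Finset.Iic β).card * c) := by
  refine ((Covers.gets (covers_of_subset (Set.singleton_subset_iff.mpr h0))).union
    (Gets.biUnion _ h)).mono_cost (by lia) |>.of_covers ?_
  rintro _ ⟨s, rfl⟩
  by_cases hs : s ∈ Finset.Iic β
  · exact ⟨_, .inr (Set.mem_biUnion hs rfl), fun _ _ => rfl⟩
  · refine ⟨_, .inl rfl, fun ω hω => ?_⟩
    exact (notMem_support_iff.mp fun h => hs (hg ω hω h)).symm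

omit [∀ ω, Differential (F ω)] in
theorem coeff_mem (hg : coeffs g ⊆ K) (s : Mon n) : (fun ω => (g ω).coeff s) ∈ K :=
  hg ⟨s, rfl⟩

theorem card_antidiagonal_le {s : Mon n} (hs : s ∈ Finset.Iic β) :
    (Finset.HasAntidiagonal.antidiagonal s).card ≤ (Finset.Iic β).card := by
  classical
  refine Finset.card_le_card_of_injOn Prod.fst (fun a ha => ?_) ?_
  · have ha' := Finset.HasAntidiagonal.mem_antidiagonal.mp ha
    have hs' := Finset.mem_Iic.mp hs
    refine Finset.mem_coe.mpr (Finset.mem_Iic.mpr (le_trans ?_ hs'))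
    rw [← ha']
    exact le_self_add
  · intro a ha b hb hab
    have ha' := Finset.HasAntidiagonal.mem_antidiagonal.mp ha
    have hb' := Finset.HasAntidiagonal.mem_antidiagonal.mp hb
    refine Prod.ext hab ?_
    rw [← hb', hab] at ha'
    exact add_left_cancel ha'

theorem Gets.mul (h0 : (fun _ => 0) ∈ K) (hf : coeffs f ⊆ K) (hg : coeffs g ⊆ K)
    (hfg : ∀ ω ∈ P, (f ω * g ω).support ⊆ Finset.Iic β) :
    Gets x goal P K (coeffs fun ω => f ω * g ω)
      ((Finset.Iic β).card * (2 * (Finset.Iic β).card)) := by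
  classical
  refine Gets.of_coeff (g := fun ω => f ω * g ω) h0 hfg fun s hs => ?_
  have h1 : Gets x goal P K
      {fun ω => ∑ i ∈ Finset.HasAntidiagonal.antidiagonal s, (f ω).coeff i.1 * (g ω).coeff i.2}
      (2 * (Finset.HasAntidiagonal.antidiagonal s).card) :=
    Gets.sum_mul _ (fun i _ => coeff_mem hf i.1) (fun i _ => coeff_mem hg i.2) h0
  have h2 : (fun ω => (f ω * g ω).coeff s) = fun ω =>
      ∑ i ∈ Finset.HasAntidiagonal.antidiagonal s, (f ω).coeff i.1 * (g ω).coeff i.2 :=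
    funext fun ω => coeff_mul _ _ _
  rw [h2]
  exact h1.mono_cost (Nat.mul_le_mul_left _ (card_antidiagonal_le hs))

theorem Gets.sub (h0 : (fun _ => 0) ∈ K) (hf : coeffs f ⊆ K) (hg : coeffs g ⊆ K)
    (hfg : ∀ ω ∈ P, (f ω - g ω).support ⊆ Finset.Iic β) :
    Gets x goal P K (coeffs fun ω => f ω - g ω) (Finset.Iic β).card := by
  refine (Gets.of_coeff (c := 1) h0 hfg fun s _ => ?_).mono_cost (mul_one _).le
  simp only [coeff_sub]
  exact Gets.arith .minus (coeff_mem hf s) (coeff_mem hg s)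

theorem Gets.add (h0 : (fun _ => 0) ∈ K) (hf : coeffs f ⊆ K) (hg : coeffs g ⊆ K)
    (hfg : ∀ ω ∈ P, (f ω + g ω).support ⊆ Finset.Iic β) :
    Gets x goal P K (coeffs fun ω => f ω + g ω) (Finset.Iic β).card := by
  refine (Gets.of_coeff (c := 1) h0 hfg fun s _ => ?_).mono_cost (mul_one _).le
  simp only [coeff_add]
  exact Gets.arith .plus (coeff_mem hf s) (coeff_mem hg s)

theorem Gets.finsetSum {ι : Type*} (S : Finset ι) {f : ι → ∀ ω, DiffPoly (F ω) n}
    (h0 : (fun _ => 0) ∈ K) (hf : ∀ i ∈ S, coeffs (f i) ⊆ K)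
    (hS : ∀ ω ∈ P, (∑ i ∈ S, f i ω).support ⊆ Finset.Iic β) :
    Gets x goal P K (coeffs fun ω => ∑ i ∈ S, f i ω) ((Finset.Iic β).card * S.card) := by
  refine .of_coeff h0 hS fun s _ => ?_
  simp only [coeff_sum]
  exact .sum S (fun i hi => coeff_mem (hf i hi) s) h0

-- Extracting a coefficient in `v`, like multiplying by a power of a variable below, only re-indexes
-- known coefficients and zeros, and costs nothing.
omit [∀ ω, Differential (F ω)] in
theorem coeffs_coeffAt_subset (v : Deriv n) (d : ℕ) (h0 : (fun _ => 0) ∈ K)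
    (hf : coeffs f ⊆ K) : coeffs (fun ω => coeffAt v d (f ω)) ⊆ K := by
  rintro _ ⟨s, rfl⟩
  simp only [coeff_coeffAt]
  split_ifs
  exacts [coeff_mem hf _, h0]

omit [∀ ω, Differential (F ω)] in
theorem coeffs_X_mul_subset (v : Deriv n) (h0 : (fun _ => 0) ∈ K) (hf : coeffs f ⊆ K) :
    coeffs (fun ω => X v * f ω) ⊆ K := by
  classical
  rintro _ ⟨s, rfl⟩
  simp only [coeff_X_mul']
  split_ifs
  exacts [coeff_mem hf _, h0]

omit [∀ ω, Differential (F ω)] in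
theorem coeffs_X_pow_mul_subset (v : Deriv n) (j : ℕ) (h0 : (fun _ => 0) ∈ K)
    (hf : coeffs f ⊆ K) : coeffs (fun ω => X v ^ j * f ω) ⊆ K := by
  induction j with
  | zero => simpa using hf
  | succ j ih =>
    simp only [pow_succ', mul_assoc]
    exact coeffs_X_mul_subset v h0 ih

/-- The integer factors are realised by repeated addition, at most `β v + 1` times per coefficient.
-/
theorem Gets.pderiv (v : Deriv n) (h0 : (fun _ => 0) ∈ K) (hf : coeffs f ⊆ K)
    (hfβ : ∀ ω ∈ P, (pderiv v (f ω)).support ⊆ Finset.Iic β) :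
    Gets x goal P K (coeffs fun ω => pderiv v (f ω)) ((Finset.Iic β).card * (β v + 1)) := by
  refine .of_coeff h0 hfβ fun s hs => ?_
  have h1 := Gets.sum (x := x) (goal := goal) (P := P) (Finset.range (s v + 1))
    (a := fun _ ω => (f ω).coeff (s + Finsupp.single v 1)) (fun _ _ => coeff_mem hf _) h0
  have h2 : s v ≤ β v := Finset.mem_Iic.mp hs v
  rw [Finset.card_range] at h1
  convert h1.mono_cost (c' := β v + 1) (by lia) using 3
  rw [coeff_pderiv, Finset.sum_const, Finset.card_range, nsmul_eq_mul]
  push_cast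
  ring

theorem Gets.coeffDeriv (h0 : (fun _ => 0) ∈ K) (hf : coeffs f ⊆ K)
    (hfβ : ∀ ω ∈ P, (coeffDeriv (f ω)).support ⊆ Finset.Iic β) :
    Gets x goal P K (coeffs fun ω => coeffDeriv (f ω)) (Finset.Iic β).card := by
  refine (Gets.of_coeff (c := 1) h0 hfβ fun s _ => ?_).mono_cost (mul_one _).le
  simp only [coeff_coeffDeriv]
  exact .deriv (coeff_mem hf s)

/-- The monomial `∏ v ∈ V, v ^ D`; its divisors are the monomials in `V` of degree at most `D` in
each variable. -/
noncomputable def boxMon (V : Finset (Deriv n)) (D : ℕ) : Mon n :=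
  Finsupp.indicator V fun _ _ => D

theorem boxMon_apply [DecidableEq (Deriv n)] (V : Finset (Deriv n)) (D : ℕ) (v : Deriv n) :
    boxMon V D v = if v ∈ V then D else 0 := by
  rw [boxMon, Finsupp.indicator_apply]
  split_ifs <;> rfl

theorem card_Iic_boxMon (V : Finset (Deriv n)) (D : ℕ) :
    (Finset.Iic (boxMon V D)).card = (D + 1) ^ V.card := by
  classical
  rw [Finsupp.card_Iic]
  have hsub : (boxMon V D).support ⊆ V := Finsupp.support_indicator_subset _ _
  rw [Finset.prod_subset hsub fun v _ hv => by
    rw [Finsupp.notMem_support_iff.mp hv]; rfl]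
  rw [Finset.prod_congr rfl fun v hv => by
    rw [boxMon_apply, if_pos hv, Nat.card_Iic], Finset.prod_const]

theorem support_subset_Iic_boxMon {k : Type*} [Field k] {V : Finset (Deriv n)} {D : ℕ}
    {g : DiffPoly k n} (hV : g.vars ⊆ V) (hD : g.totalDegree ≤ D) :
    g.support ⊆ Finset.Iic (boxMon V D) := by
  classical
  intro s hs
  refine Finset.mem_Iic.mpr fun v => ?_
  rw [boxMon_apply]
  split_ifs with hv
  · exact (((degreeOf_le_iff (n := v)).mp le_rfl s hs).trans (degreeOf_le_totalDegree g v)).trans hD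
  · by_contra h
    exact hv (hV ((mem_vars_iff_mem_support v).mpr
      ⟨s, hs, Finsupp.mem_support_iff.mpr fun h' => h h'.le⟩))

variable {S : Finset (Deriv n)} {N : ℕ}

/-- The number of monomials in `S` of degree at most `N` in each variable. -/
abbrev boxCard (S : Finset (Deriv n)) (N : ℕ) : ℕ := (N + 1) ^ S.card

theorem Gets.δ (h0 : (fun _ => 0) ∈ K) (hf : coeffs f ⊆ K)
    (hS : ∀ ω ∈ P, (f ω).vars ⊆ S ∧ (DiffRed.δ (f ω)).vars ⊆ S)
    (hN : ∀ ω ∈ P, (f ω).totalDegree ≤ N) :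
    Gets x goal P K (coeffs fun ω => DiffRed.δ (f ω))
      (boxCard S N * (S.card * (N + 2) + 2)) := by
  classical
  have hfβ : ∀ ω ∈ P, (f ω).support ⊆ Finset.Iic (boxMon S N) := fun ω hω =>
    support_subset_Iic_boxMon (hS ω hω).1 (hN ω hω)
  have hδβ : ∀ ω ∈ P, (DiffRed.δ (f ω)).support ⊆ Finset.Iic (boxMon S N) := fun ω hω =>
    support_subset_Iic_boxMon (hS ω hω).2 ((totalDegree_δ_le _).trans (hN ω hω))
  have hcβ : ∀ ω ∈ P, (DiffRed.coeffDeriv (f ω)).support ⊆ Finset.Iic (boxMon S N) :=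
    fun ω hω => (support_coeffDeriv_subset _).trans (hfβ ω hω)
  have hpβ : ∀ v, ∀ ω ∈ P, (MvPolynomial.pderiv v (f ω)).support ⊆ Finset.Iic (boxMon S N) := by
    intro v ω hω s hs
    have := Finset.mem_Iic.mp (hfβ ω hω (mem_support_pderiv hs))
    exact Finset.mem_Iic.mpr (le_self_add.trans this)
  have hsβ : ∀ ω ∈ P, (∑ v ∈ S, X (v.1, v.2 + 1) * MvPolynomial.pderiv v (f ω)).support ⊆
      Finset.Iic (boxMon S N) := by
    intro ω hω
    -- The set `S` need not contain the shift of each of its elements. So the sum is bounded as the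
    -- difference of `δ f` and its coefficient part, which both lie in the box.
    rw [← sub_eq_of_eq_add' (δ_eq (f ω) (hS ω hω).1)]
    exact (support_sub _ _ _).trans (Finset.union_subset (hδβ ω hω) (hcβ ω hω))
  have h1 : Gets x goal P K (coeffs fun ω => DiffRed.coeffDeriv (f ω)) (boxCard S N) := by
    have := Gets.coeffDeriv (x := x) (goal := goal) h0 hf hcβ
    rwa [card_Iic_boxMon] at this
  have h2 : Gets x goal P K (⋃ v ∈ S, coeffs fun ω => MvPolynomial.pderiv v (f ω))
      (S.card * (boxCard S N * (N + 1))) := by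
    refine .biUnion S fun v hv => ?_
    have := Gets.pderiv (x := x) (goal := goal) v h0 hf (hpβ v)
    rwa [card_Iic_boxMon, boxMon_apply, if_pos hv] at this
  have h3 : Gets x goal P K
      (coeffs fun ω => ∑ v ∈ S, X (v.1, v.2 + 1) * MvPolynomial.pderiv v (f ω))
      (S.card * (boxCard S N * (N + 1)) + boxCard S N * S.card) := by
    refine h2.trans ?_
    have := Gets.finsetSum (x := x) (goal := goal) (P := P)
      (K := K ∪ ⋃ v ∈ S, coeffs fun ω => MvPolynomial.pderiv v (f ω)) (β := boxMon S N) S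
      (f := fun v ω => X (v.1, v.2 + 1) * MvPolynomial.pderiv v (f ω)) (.inl h0)
      (fun v hv => coeffs_X_mul_subset _ (.inl h0)
        ((Set.subset_biUnion_of_mem (u := fun v => coeffs fun ω => MvPolynomial.pderiv v (f ω))
          hv).trans Set.subset_union_right)) hsβ
    rwa [card_Iic_boxMon] at this
  have h4 := (h1.union h3).trans (Gets.add (f := fun ω => DiffRed.coeffDeriv (f ω))
    (g := fun ω => ∑ v ∈ S, X (v.1, v.2 + 1) * MvPolynomial.pderiv v (f ω))
    (β := boxMon S N) (.inl h0)
    (Set.subset_union_left.trans Set.subset_union_right)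
    (Set.subset_union_right.trans Set.subset_union_right)
    fun ω hω => by
      rw [← δ_eq (f ω) (hS ω hω).1]
      exact hδβ ω hω)
  refine (h4.mono_cost ?_).of_covers ?_
  · rw [card_Iic_boxMon]
    exact le_of_eq (by ring)
  · rintro _ ⟨s, rfl⟩
    refine ⟨_, ⟨s, rfl⟩, fun ω hω => ?_⟩
    simp only
    rw [δ_eq (f ω) (hS ω hω).1]

theorem Gets.iterate_δ (h0 : (fun _ => 0) ∈ K) (hf : coeffs f ⊆ K) (h : ℕ)
    (hS : ∀ ω ∈ P, ∀ k ≤ h, (DiffRed.δ^[k] (f ω)).vars ⊆ S)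
    (hN : ∀ ω ∈ P, (f ω).totalDegree ≤ N) :
    Gets x goal P K (⋃ k ∈ Finset.range (h + 1), coeffs fun ω => DiffRed.δ^[k] (f ω))
      (h * (boxCard S N * (S.card * (N + 2) + 2))) := by
  classical
  induction h with
  | zero =>
    rw [zero_mul]
    exact (covers_of_subset (by simpa using hf)).gets
  | succ h ih =>
    rw [Finset.range_add_one, Finset.set_biUnion_insert, Set.union_comm, add_mul, one_mul]
    refine (ih fun ω hω k hk => hS ω hω k (by lia)).trans_union ?_
    simp only [Function.iterate_succ_apply']
    refine .δ (.inl h0) ?_ (fun ω hω => ⟨hS ω hω h (by lia), ?_⟩)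
      fun ω hω => (totalDegree_iterate_δ_le _ _).trans (hN ω hω)
    · exact (Set.subset_biUnion_of_mem (u := fun k => coeffs fun ω => DiffRed.δ^[k] (f ω))
        (Finset.self_mem_range_succ h)).trans Set.subset_union_right
    · rw [← Function.iterate_succ_apply' (f := DiffRed.δ)]
      exact hS ω hω (h + 1) le_rfl

theorem Gets.elimStep {v : Deriv n} {d j : ℕ} (h0 : (fun _ => 0) ∈ K) (hf : coeffs f ⊆ K)
    (hg : coeffs g ⊆ K)
    (hS : ∀ ω ∈ P, (f ω).vars ⊆ S ∧ (g ω).vars ⊆ S) (hv : v ∈ S)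
    (hN : ∀ ω ∈ P, (f ω).totalDegree + ((g ω).totalDegree - d) ≤ N) :
    Gets x goal P K (coeffs fun ω => DiffRed.elimStep v d (g ω) j (f ω))
      (5 * boxCard S N ^ 2) := by
  classical
  have hβ₁ : ∀ ω ∈ P, (coeffAt v d (g ω) * f ω).support ⊆ Finset.Iic (boxMon S N) :=
    fun ω hω => support_subset_Iic_boxMon ((vars_mul _ _).trans (Finset.union_subset
      ((vars_coeffAt_subset _ _ _).trans (hS ω hω).2) (hS ω hω).1))
      (totalDegree_coeffAt_mul_le.trans (hN ω hω))
  have hβ₂ : ∀ ω ∈ P, (coeffAt v (d + j) (f ω) * (X v ^ j * g ω)).support ⊆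
      Finset.Iic (boxMon S N) := by
    intro ω hω
    refine support_subset_Iic_boxMon ((vars_mul _ _).trans (Finset.union_subset
      ((vars_coeffAt_subset _ _ _).trans (hS ω hω).1) ((vars_mul _ _).trans
        (Finset.union_subset ?_ (hS ω hω).2))))
      (totalDegree_coeffAt_mul_X_pow_mul_le.trans (hN ω hω))
    refine (vars_pow _ _).trans ?_
    rw [vars_X]
    exact Finset.singleton_subset_iff.mpr hv
  have h1 := Gets.mul (x := x) (goal := goal) (P := P) h0
    (coeffs_coeffAt_subset v d h0 hg) hf hβ₁
  have h2 := Gets.mul (x := x) (goal := goal) (P := P) h0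
    (coeffs_coeffAt_subset v (d + j) h0 hf) (coeffs_X_pow_mul_subset v j h0 hg) hβ₂
  have h3 := (h1.union h2).trans (Gets.sub (.inl h0)
    (Set.subset_union_left.trans Set.subset_union_right)
    (Set.subset_union_right.trans Set.subset_union_right)
    fun ω hω => (support_sub _ _ _).trans (Finset.union_subset (hβ₁ ω hω) (hβ₂ ω hω)))
  refine h3.mono_cost ?_
  rw [card_Iic_boxMon]
  have : boxCard S N ≤ boxCard S N ^ 2 := Nat.le_self_pow two_ne_zero _
  change boxCard S N * (2 * boxCard S N) + boxCard S N * (2 * boxCard S N) + boxCard S N ≤ _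
  nlinarith

theorem Gets.elimSteps {v : Deriv n} {d j : ℕ} (h0 : (fun _ => 0) ∈ K) (hf : coeffs f ⊆ K)
    (hg : coeffs g ⊆ K)
    (hS : ∀ ω ∈ P, (f ω).vars ⊆ S ∧ (g ω).vars ⊆ S) (hvS : v ∈ S)
    (hv : ∀ ω ∈ P, v ∈ (g ω).vars)
    (hN : ∀ ω ∈ P, (f ω).totalDegree + j * ((g ω).totalDegree - d) ≤ N) :
    Gets x goal P K (coeffs fun ω => DiffRed.elimSteps v d (g ω) j (f ω))
      (j * (5 * boxCard S N ^ 2)) := by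
  classical
  induction j generalizing f K with
  | zero => exact ((covers_of_subset hf).gets).mono_cost (Nat.zero_le _)
  | succ j ih =>
    have h1 := Gets.elimStep (x := x) (goal := goal) (P := P) (S := S) (N := N) (v := v) (d := d)
      (j := j) h0 hf hg hS hvS fun ω hω => by
        have := hN ω hω
        rw [add_mul] at this
        lia
    refine (h1.trans (ih (.inl h0) Set.subset_union_right (hg.trans Set.subset_union_left)
      (fun ω hω => ⟨?_, (hS ω hω).2⟩) fun ω hω => ?_)).mono_cost (le_of_eq (by ring))
    · exact (vars_elimStep_subset (hv ω hω)).trans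
        (Finset.union_subset (hS ω hω).1 (hS ω hω).2)
    · have h2 := hN ω hω
      have h3 := totalDegree_elimStep_le (v := v) (d := d) (j := j) (f := f ω) (g := g ω)
      rw [add_mul] at h2
      lia

end PolynomialArithmetic

/-! ### Cost of a pseudo-remainder sequence -/

section Chain

open MvPolynomial

universe w

variable {Ω : Type w} {F : Ω → Type u} [∀ ω, Field (F ω)] {n : ℕ}

/-- The two fields may differ: this compares degrees between instances over different fields. -/
theorem degreeOf_eq_of_support_eq {k k' : Type*} [Field k] [Field k'] {f : DiffPoly k n}
    {g : DiffPoly k' n} (h : f.support = g.support) (v : Deriv n) :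
    f.degreeOf v = g.degreeOf v := by
  rw [degreeOf_eq_sup, degreeOf_eq_sup, h]

theorem vars_eq_of_support_eq {k k' : Type*} [Field k] [Field k'] {f : DiffPoly k n}
    {g : DiffPoly k' n} (h : f.support = g.support) : f.vars = g.vars := by
  ext v
  rw [mem_vars_iff_mem_support, mem_vars_iff_mem_support, h]

theorem support_eq_of_coeff_eq_zero_iff {k k' : Type*} [Field k] [Field k'] {f : DiffPoly k n}
    {g : DiffPoly k' n} {T : Finset (Mon n)} (hf : f.support ⊆ T) (hg : g.support ⊆ T)
    (h : ∀ s ∈ T, f.coeff s = 0 ↔ g.coeff s = 0) : f.support = g.support := by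
  ext s
  by_cases hs : s ∈ T
  · rw [mem_support_iff, mem_support_iff, ne_eq, h s hs]
  · exact ⟨fun h' => absurd (hf h') hs, fun h' => absurd (hg h') hs⟩

variable [∀ ω, Differential (F ω)] {I : Type}
variable {x : ∀ ω, I → F ω} {goal : Mon n → ∀ ω, F ω} {P : Set Ω} {K : Set (∀ ω, F ω)}
  {S : Finset (Deriv n)} {N m : ℕ}

theorem le_boxCard {v : Deriv n} (hv : v ∈ S) : N + 1 ≤ boxCard S N :=
  Nat.le_self_pow (Finset.card_ne_zero_of_mem hv) _

theorem Gets.pseudoRem {f g : ∀ ω, DiffPoly (F ω) n} {v : Deriv n} {d e : ℕ}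
    (h0 : (fun _ => 0) ∈ K) (hf : coeffs f ⊆ K) (hg : coeffs g ⊆ K)
    (hS : ∀ ω ∈ P, (f ω).vars ⊆ S ∧ (g ω).vars ⊆ S) (hvS : v ∈ S)
    (hv : ∀ ω ∈ P, v ∈ (g ω).vars) (hd : ∀ ω ∈ P, (g ω).degreeOf v = d)
    (he : ∀ ω ∈ P, (f ω).degreeOf v = e) (hm : ∀ ω ∈ P, (g ω).totalDegree ≤ m)
    (hN : ∀ ω ∈ P, (m + 1) * ((f ω).totalDegree + 1) ≤ N + 1) :
    Gets x goal P K (coeffs fun ω => DiffRed.pseudoRem v (g ω) (f ω))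
      (boxCard S N * (5 * boxCard S N ^ 2)) := by
  -- The number `e + 1 - d` of steps is bounded through the degree of an actual instance, so the
  -- empty class is treated apart.
  rcases P.eq_empty_or_nonempty with rfl | ⟨ω₀, hω₀⟩
  · exact fun _ _ _ _ => .of_isEmpty rfl
  have hj : ∀ ω ∈ P, e + 1 - d ≤ (f ω).totalDegree := fun ω hω => by
    have h1 := degreeOf_le_totalDegree (f ω) v
    have h2 := mem_vars_iff_degreeOf_ne_zero.mp (hv ω hω)
    rw [he ω hω] at h1
    rw [hd ω hω] at h2
    lia
  have hfm : ∀ ω ∈ P, (f ω).totalDegree + (f ω).totalDegree * m ≤ N := fun ω hω => by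
    have h1 := hN ω hω
    have h2 : (m + 1) * ((f ω).totalDegree + 1) =
      (f ω).totalDegree + (f ω).totalDegree * m + m + 1 := by ring
    lia
  have h1 := Gets.elimSteps (x := x) (goal := goal) (P := P) (S := S) (N := N) (v := v) (d := d)
    (j := e + 1 - d) h0 hf hg hS hvS hv fun ω hω => by
      have h1 := Nat.mul_le_mul (hj ω hω)
        ((Nat.sub_le _ d).trans (hm ω hω) : (g ω).totalDegree - d ≤ m)
      have h2 := hfm ω hω
      lia
  refine (h1.mono_cost (Nat.mul_le_mul_right _ ?_)).of_covers ?_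
  · have h2 := hj ω₀ hω₀
    have h3 := hfm ω₀ hω₀
    have h4 := le_boxCard (N := N) hvS
    lia
  · rintro _ ⟨s, rfl⟩
    refine ⟨_, ⟨s, rfl⟩, fun ω hω => ?_⟩
    simp only [DiffRed.pseudoRem]
    rw [hd ω hω, he ω hω]

/-- Before each division all coefficients of the current polynomial are tested for zero. This fixes
its degree in `v`, and with it the number of elimination steps. The hypothesis `hN` is a degree
budget: each division uses up one factor `m + 1`. -/
theorem Solves.iterPseudoRem (L : List (Deriv n × ∀ ω, DiffPoly (F ω) n))
    {f : ∀ ω, DiffPoly (F ω) n} (h0 : (fun _ => 0) ∈ K) (hf : coeffs f ⊆ K)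
    (hL : ∀ a ∈ L, coeffs a.2 ⊆ K ∧ a.1 ∈ S)
    (hg : ∀ ω ∈ P, ∀ a ∈ L,
      a.1 ∈ (a.2 ω).vars ∧ (a.2 ω).vars ⊆ S ∧ (a.2 ω).totalDegree ≤ m)
    (hd : ∀ a ∈ L, ∃ d, ∀ ω ∈ P, (a.2 ω).degreeOf a.1 = d)
    (hfS : ∀ ω ∈ P, (f ω).vars ⊆ S)
    (hN : ∀ ω ∈ P, (m + 1) ^ L.length * ((f ω).totalDegree + 1) ≤ N + 1)
    (hgoal : ∀ s, ∀ ω ∈ P,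
      goal s ω = (DiffRed.iterPseudoRem (L.map fun a => (a.1, a.2 ω)) (f ω)).coeff s) :
    Solves x goal P K (L.length * (boxCard S N + boxCard S N * (5 * boxCard S N ^ 2))) := by
  induction L generalizing P K f with
  | nil =>
    rw [List.length_nil, zero_mul]
    exact .halt fun s => ⟨_, coeff_mem hf s, fun ω hω => (hgoal s ω hω).symm⟩
  | cons a L ih =>
    obtain ⟨v, g⟩ := a
    obtain ⟨⟨hgK, hvS⟩, hL⟩ := List.forall_mem_cons.mp hL
    obtain ⟨⟨d, hgd⟩, hd⟩ := List.forall_mem_cons.mp hd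
    have hgP := fun ω hω => (List.forall_mem_cons.mp (hg ω hω)).1
    have hg' := fun ω hω => (List.forall_mem_cons.mp (hg ω hω)).2
    simp only [List.length_cons] at hN
    have hN' : ∀ ω ∈ P, (m + 1) * ((f ω).totalDegree + 1) ≤ N + 1 := fun ω hω => by
      refine le_trans (Nat.mul_le_mul_right _ ?_) (hN ω hω)
      exact Nat.le_self_pow (Nat.succ_ne_zero _) _
    have hβ : ∀ ω ∈ P, (f ω).support ⊆ Finset.Iic (boxMon S N) := fun ω hω =>
      support_subset_Iic_boxMon (hfS ω hω) (by
        have h1 := hN' ω hω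
        have h2 : (f ω).totalDegree + 1 ≤ (m + 1) * ((f ω).totalDegree + 1) :=
          Nat.le_mul_of_pos_left _ (Nat.succ_pos _)
        lia)
    have key : Solves x goal P K ((L.length * (boxCard S N + boxCard S N * (5 * boxCard S N ^ 2)) +
        boxCard S N * (5 * boxCard S N ^ 2)) + (Finset.Iic (boxMon S N)).card) := by
      refine .tests (Finset.Iic (boxMon S N)) (a := fun s ω => (f ω).coeff s)
        (fun s _ => coeff_mem hf s) fun ω₀ hω₀ => ?_
      set P' := P ∩ {ω | ∀ s ∈ Finset.Iic (boxMon S N), (f ω).coeff s = 0 ↔ (f ω₀).coeff s = 0}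
        with hP'
      have hPP : P' ⊆ P := Set.inter_subset_left
      have hdeg : ∀ ω ∈ P', (f ω).degreeOf v = (f ω₀).degreeOf v := fun ω hω =>
        degreeOf_eq_of_support_eq (support_eq_of_coeff_eq_zero_iff (hβ ω (hPP hω)) (hβ ω₀ hω₀)
          hω.2) v
      refine Gets.solves (Gets.pseudoRem (m := m) h0 hf hgK
        (fun ω hω => ⟨hfS ω (hPP hω), (hgP ω (hPP hω)).2.1⟩) hvS
        (fun ω hω => (hgP ω (hPP hω)).1) (fun ω hω => hgd ω (hPP hω)) hdeg
        (fun ω hω => (hgP ω (hPP hω)).2.2) (fun ω hω => hN' ω (hPP hω))) ?_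
      refine ih (.inl h0) Set.subset_union_right
        (fun b hb => ⟨(hL b hb).1.trans Set.subset_union_left, (hL b hb).2⟩)
        (fun ω hω => hg' ω (hPP hω))
        (fun b hb => (hd b hb).imp fun d hd ω hω => hd ω (hPP hω)) (fun ω hω => ?_)
        (fun ω hω => ?_) (fun s ω hω => hgoal s ω (hPP hω))
      · exact (vars_elimSteps_subset (hgP ω (hPP hω)).1).trans
          (Finset.union_subset (hfS ω (hPP hω)) (hgP ω (hPP hω)).2.1)
      · refine le_trans ?_ (hN ω (hPP hω))
        rw [pow_succ, mul_assoc]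
        exact Nat.mul_le_mul_left _
          (totalDegree_pseudoRem_lt (hgP ω (hPP hω)).1 (hgP ω (hPP hω)).2.2)
    refine key.mono_cost (le_of_eq ?_)
    rw [card_Iic_boxMon, List.length_cons]
    ring

/-- Zero is available at no cost: it stands in the initially empty register `0`, so fresh registers
start at `1`. -/
theorem Solves.exists_compTree {O : Type} {goal : O → ∀ ω, F ω} {c : ℕ}
    (h : Solves x goal Set.univ (insert (fun _ => 0) (Set.range fun i ω => x ω i)) c) :
    ∃ T : CompTree I O, ∀ ω, (∀ o, T.output (x ω) o = goal o ω) ∧ T.cost (x ω) ≤ c := by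
  classical
  have hloc : ∀ κ : ∀ ω, F ω, ∃ l : Operand I,
      κ ∈ insert (fun _ => 0) (Set.range fun i ω => x ω i) →
        (∀ k, l = Sum.inr k → k < 1) ∧ ∀ ω, Operand.val (x ω) (fun _ => 0) l = κ ω := by
    intro κ
    by_cases hκ : κ ∈ insert (fun _ => 0) (Set.range fun i ω => x ω i)
    · rcases hκ with rfl | ⟨i, rfl⟩
      · refine ⟨Sum.inr 0, fun _ => ⟨fun k hk => ?_, fun _ => rfl⟩⟩
        rw [← Sum.inr.inj hk]
        exact one_pos
      · exact ⟨Sum.inl i, fun _ => ⟨fun k hk => (Sum.inl_ne_inr hk).elim, fun _ => rfl⟩⟩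
    · exact ⟨Sum.inr 0, fun h => absurd h hκ⟩
  choose loc hloc using hloc
  obtain ⟨T, hT⟩ := h loc 1 fun κ hκ => (hloc κ hκ).1
  exact ⟨T, fun ω => hT ω trivial _ fun κ hκ => (hloc κ hκ).2 ω⟩

end Chain

/-! ### The uniform tree and its cost -/

section Main

open MvPolynomial

/-- The data of a reduction with given parameters. -/
structure ReductionData (n p h e m D : ℕ) (R : Ranking n) where
  F : Type u
  [field : Field F]
  [charZero : CharZero F]
  [differential : Differential F]
  A : Fin p → DiffPoly F n
  f : DiffPoly F n
  autoReduced : R.IsAutoReduced A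
  order_f : order f = h
  totalDegree_f : f.totalDegree = D
  order_A : (Finset.univ.sup fun i => order (A i)) = e
  totalDegree_A : (Finset.univ.sup fun i => (A i).totalDegree) = m

attribute [instance] ReductionData.field ReductionData.charZero ReductionData.differential

variable {n p h e m D : ℕ} {R : Ranking n}

namespace ReductionData

variable (ω : ReductionData.{u} n p h e m D R)

theorem totalDegree_le (i : Fin p) : (ω.A i).totalDegree ≤ m :=
  (Finset.le_sup (f := fun i => (ω.A i).totalDegree) (Finset.mem_univ i)).trans ω.totalDegree_A.le

theorem exists_leader : ∃ u : Fin p → Deriv n, ∀ i, R.IsLeader (ω.A i) (u i) := by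
  choose u hu using ω.autoReduced.1
  exact ⟨u, hu⟩

theorem exists_remainder : ∃ r : DiffPoly ω.F n, R.IsDifferentialRemainder ω.A ω.f r ∧
    (∀ i, R.IsReduced r (ω.A i)) ∧
    (∃ (u : Fin p → Deriv n) (a b : Fin p → ℕ), (∀ i, R.IsLeader (ω.A i) (u i)) ∧
      (∏ i, separant (u i) (ω.A i) ^ a i * initial (u i) (ω.A i) ^ b i) * ω.f - r
        ∈ diffIdeal ω.A) ∧
    r.totalDegree ≤ (m + 1) ^ (p * (h + 1)) * (D + 1) - 1 := by
  obtain ⟨u, hu⟩ := ω.exists_leader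
  obtain ⟨L, hL, hP, hlen⟩ := R.exists_reductionList (ω.autoReduced.injective_fst hu) h
  have hL' : ∀ i k, (i, k) ∈ L ↔ k ≤ order ω.f := by
    rw [ω.order_f]
    exact hL
  obtain ⟨a, b, hab⟩ := exists_prod_mul_sub_mem hu
    (isIterated_iterPseudoRem (L := reducers u ω.A L) (mem_reducers_vars hu) ω.f)
  refine ⟨_, isDifferentialRemainder_iterPseudoRem hu hL' hP,
    isReduced_iterPseudoRem ω.autoReduced hu hL' hP, ⟨u, a, b, hu, hab⟩, ?_⟩
  have h1 := totalDegree_iterPseudoRem_lt (L := reducers u ω.A L) (m := m) (fun a ha =>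
    ⟨mem_reducers_vars hu a ha, by
      obtain ⟨⟨i, k⟩, -, rfl⟩ := List.mem_map.mp ha
      exact (totalDegree_iterate_δ_le _ _).trans (ω.totalDegree_le i)⟩) ω.f
  rw [reducers, List.length_map, hlen, ω.totalDegree_f] at h1
  exact Nat.le_sub_one_of_lt h1

/-- The differential remainder. -/
noncomputable def rem : DiffPoly ω.F n := ω.exists_remainder.choose

theorem vars_iterate_δ_subset (i : Fin p) {k : ℕ} (hk : k ≤ h) :
    (δ^[k] (ω.A i)).vars ⊆ Finset.univ ×ˢ Finset.range (e + h + 1) := by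
  intro w hw
  obtain ⟨v, hv, j, hj, rfl⟩ := mem_vars_iterate_δ hw
  have h1 := le_order hv
  have h2 : order (ω.A i) ≤ e :=
    (Finset.le_sup (f := fun i => order (ω.A i)) (Finset.mem_univ i)).trans ω.order_A.le
  simp only [Finset.mem_product, Finset.mem_univ, Finset.mem_range, true_and]
  lia

theorem vars_subset : ω.f.vars ⊆ Finset.univ ×ˢ Finset.range (e + h + 1) := by
  intro w hw
  have h1 := le_order hw
  rw [ω.order_f] at h1
  simp only [Finset.mem_product, Finset.mem_univ, Finset.mem_range, true_and]
  lia

theorem one_le (ω : ReductionData.{u} n p h e m D R) (i : Fin p) : 1 ≤ m ∧ 1 ≤ n := by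
  obtain ⟨v, hv⟩ := ω.autoReduced.1 i
  have h1 := mem_vars_iff_degreeOf_ne_zero.mp hv.1
  have h2 := degreeOf_le_totalDegree (ω.A i) v
  have h3 := ω.totalDegree_le i
  have h4 := v.1.pos
  exact ⟨by lia, h4⟩

end ReductionData

/-- Zero tests on the coefficients of all `A i` fix their supports, hence the leaders and the order
of reduction. Within such a class the derivatives are computed, and then the pseudo-remainder
sequence. The three summands of the cost are those of the sequence, of the derivatives and of the
tests. -/
theorem solves_rem {N : ℕ} {S : Finset (Deriv n)}
    (hN : (m + 1) ^ (p * (h + 1)) * (D + 1) = N + 1)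
    (hS : S = Finset.univ ×ˢ Finset.range (e + h + 1)) :
    Solves (fun ω : ReductionData.{u} n p h e m D R => coeffInput ω.A ω.f)
      (fun s ω => ω.rem.coeff s) Set.univ
      (insert (fun _ => 0) (Set.range fun i ω => coeffInput ω.A ω.f i))
      (p * (h + 1) * (boxCard S N + boxCard S N * (5 * boxCard S N ^ 2)) +
        p * (h * (boxCard S N * (S.card * (N + 2) + 2))) + p * boxCard S N) := by
  classical
  set K : Set (∀ ω : ReductionData.{u} n p h e m D R, ω.F) :=
    insert (fun _ => 0) (Set.range fun i ω => coeffInput ω.A ω.f i) with hK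
  have h0 : (fun _ => 0) ∈ K := Set.mem_insert _ _
  have hfK : coeffs (fun ω : ReductionData.{u} n p h e m D R => ω.f) ⊆ K := by
    rintro _ ⟨s, rfl⟩
    exact .inr ⟨Sum.inr s, rfl⟩
  have hAK : ∀ i, coeffs (fun ω : ReductionData.{u} n p h e m D R => ω.A i) ⊆ K := by
    rintro i _ ⟨s, rfl⟩
    exact .inr ⟨Sum.inl (i, s), rfl⟩
  have hmN : Fin p → m ≤ N := fun i => by
    have hp := i.pos
    have h1 : m + 1 ≤ (m + 1) ^ (p * (h + 1)) := Nat.le_self_pow (by positivity) _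
    have h2 : (m + 1) ^ (p * (h + 1)) ≤ (m + 1) ^ (p * (h + 1)) * (D + 1) :=
      Nat.le_mul_of_pos_right _ (Nat.succ_pos _)
    lia
  have hβ : ∀ i, ∀ ω : ReductionData.{u} n p h e m D R,
      (ω.A i).support ⊆ Finset.Iic (boxMon S N) := fun i ω =>
    support_subset_Iic_boxMon (hS ▸ ω.vars_iterate_δ_subset i (Nat.zero_le h))
      ((ω.totalDegree_le i).trans (hmN i))
  have hcard : ((Finset.univ : Finset (Fin p)) ×ˢ Finset.Iic (boxMon S N)).card =
      p * boxCard S N := by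
    rw [Finset.card_product, Finset.card_univ, Fintype.card_fin, card_Iic_boxMon]
  rw [← hcard]
  refine .tests _ (a := fun i ω => (ω.A i.1).coeff i.2) (fun i _ => coeff_mem (hAK i.1) i.2)
    fun ω₀ _ => ?_
  rw [Set.univ_inter]
  set P : Set (ReductionData.{u} n p h e m D R) :=
    {ω | ∀ i ∈ (Finset.univ : Finset (Fin p)) ×ˢ Finset.Iic (boxMon S N),
      (ω.A i.1).coeff i.2 = 0 ↔ (ω₀.A i.1).coeff i.2 = 0} with hPdef
  have hsupp : ∀ ω ∈ P, ∀ i, (ω.A i).support = (ω₀.A i).support := fun ω hω i =>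
    support_eq_of_coeff_eq_zero_iff (hβ i ω) (hβ i ω₀) fun s hs =>
      hω (i, s) (Finset.mem_product.mpr ⟨Finset.mem_univ i, hs⟩)
  obtain ⟨u, hu₀⟩ := ω₀.exists_leader
  have hu : ∀ ω ∈ P, ∀ i, R.IsLeader (ω.A i) (u i) := fun ω hω i => by
    rw [Ranking.IsLeader, vars_eq_of_support_eq (hsupp ω hω i)]
    exact hu₀ i
  obtain ⟨L, hL, hPL, hlen⟩ := R.exists_reductionList (ω₀.autoReduced.injective_fst hu₀) h
  have h1 : Gets (fun ω : ReductionData.{u} n p h e m D R => coeffInput ω.A ω.f)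
      (fun s ω => ω.rem.coeff s) P K
      (⋃ i ∈ Finset.univ, ⋃ k ∈ Finset.range (h + 1), coeffs fun ω => δ^[k] (ω.A i))
      (p * (h * (boxCard S N * (S.card * (N + 2) + 2)))) := by
    have := Gets.biUnion (x := fun ω : ReductionData.{u} n p h e m D R => coeffInput ω.A ω.f)
      (goal := fun s ω => ω.rem.coeff s) (P := P) (Finset.univ : Finset (Fin p)) fun i _ =>
        Gets.iterate_δ (S := S) (N := N) h0 (hAK i) h
          (fun ω _ k hk => hS ▸ ω.vars_iterate_δ_subset i hk)
          (fun ω _ => (ω.totalDegree_le i).trans (hmN i))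
    rwa [Finset.card_univ, Fintype.card_fin] at this
  refine h1.solves ?_
  have h2 := Solves.iterPseudoRem
    (x := fun ω : ReductionData.{u} n p h e m D R => coeffInput ω.A ω.f)
    (goal := fun s ω => ω.rem.coeff s) (P := P) (S := S) (N := N) (m := m)
    (K := K ∪ ⋃ i ∈ Finset.univ, ⋃ k ∈ Finset.range (h + 1), coeffs fun ω => δ^[k] (ω.A i))
    (f := fun ω => ω.f)
    (L.map fun a => (shift (u a.1) a.2, fun ω => δ^[a.2] (ω.A a.1))) (.inl h0)
    (hfK.trans Set.subset_union_left) ?_ ?_ ?_ (fun ω _ => hS ▸ ω.vars_subset) ?_ ?_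
  · rwa [List.length_map, hlen] at h2
  · intro a ha
    obtain ⟨⟨i, k⟩, hik, rfl⟩ := List.mem_map.mp ha
    have hk := (hL i k).mp hik
    constructor
    · refine Set.Subset.trans ?_ Set.subset_union_right
      exact (Set.subset_biUnion_of_mem (u := fun k =>
          coeffs fun ω : ReductionData.{u} n p h e m D R => δ^[k] (ω.A i))
          (Finset.mem_range_succ_iff.mpr hk)).trans
        (Set.subset_biUnion_of_mem (u := fun i => ⋃ k ∈ Finset.range (h + 1),
          coeffs fun ω : ReductionData.{u} n p h e m D R => δ^[k] (ω.A i)) (Finset.mem_univ i))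
    · rw [hS]
      exact ω₀.vars_iterate_δ_subset i hk ((hu₀ i).shift_mem_vars_iterate_δ k)
  · intro ω hω a ha
    obtain ⟨⟨i, k⟩, hik, rfl⟩ := List.mem_map.mp ha
    exact ⟨(hu ω hω i).shift_mem_vars_iterate_δ k,
      hS ▸ ω.vars_iterate_δ_subset i ((hL i k).mp hik),
      (totalDegree_iterate_δ_le _ _).trans (ω.totalDegree_le i)⟩
  · intro a ha
    obtain ⟨⟨i, k⟩, hik, rfl⟩ := List.mem_map.mp ha
    -- The supports of the derivatives may vary within the class. Only the degrees in their leaders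
    -- matter, and these are 1 for `k ≥ 1`.
    cases k with
    | zero =>
      exact ⟨_, fun ω hω => degreeOf_eq_of_support_eq (hsupp ω hω i) _⟩
    | succ k => exact ⟨1, fun ω hω => (hu ω hω i).degreeOf_iterate_δ k⟩
  · intro ω _
    rw [List.length_map, hlen, ω.totalDegree_f]
    exact hN.le
  · intro s ω hω
    have h3 := isDifferentialRemainder_iterPseudoRem (hu ω hω) (L := L) (f := ω.f)
      (by rw [ω.order_f]; exact hL) hPL
    -- The remainder was chosen separately for each instance; uniqueness identifies it with the
    -- result of the common reduction list.
    have h4 : ω.rem = _ := h3.unique ω.exists_remainder.choose_spec.1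
    rw [h4, reducers, List.map_map]
    rfl

theorem reduction_cost_le {B k N : ℕ} (hB : p ≠ 0 → k ≤ B ∧ N + 1 ≤ B) :
    p * (h + 1) * (B + B * (5 * B ^ 2)) + p * (h * (B * (k * (N + 2) + 2))) + p * B ≤
      11 * (p * (h + 1)) * B ^ 3 := by
  by_cases hp : p = 0
  · simp [hp]
  obtain ⟨h1, h2⟩ := hB hp
  have hB1 : 1 ≤ B := by lia
  have h3 : B ≤ B ^ 3 := Nat.le_self_pow (by norm_num) B
  have h4 : k * (N + 2) ≤ B * (2 * B) := Nat.mul_le_mul h1 (by lia)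
  have h5 : B * (k * (N + 2) + 2) ≤ 4 * B ^ 3 := by
    calc B * (k * (N + 2) + 2) ≤ B * (B * (2 * B) + 2) := by gcongr
      _ = 2 * B ^ 3 + 2 * B := by ring
      _ ≤ 4 * B ^ 3 := by lia
  calc p * (h + 1) * (B + B * (5 * B ^ 2)) + p * (h * (B * (k * (N + 2) + 2))) + p * B
      ≤ p * (h + 1) * (B ^ 3 + 5 * B ^ 3) + p * ((h + 1) * (4 * B ^ 3)) +
        p * (h + 1) * B ^ 3 := by
        have h6 : B * (5 * B ^ 2) = 5 * B ^ 3 := by ring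
        have h7 : p ≤ p * (h + 1) := Nat.le_mul_of_pos_right _ (Nat.succ_pos _)
        rw [h6]
        gcongr
        exact Nat.le_succ h
    _ = 11 * (p * (h + 1)) * B ^ 3 := by ring

theorem exists_compTree (n p h e m D : ℕ) (R : Ranking n) :
    ∃ T : CompTree ((Fin p × Mon n) ⊕ Mon n) (Mon n),
      ∀ ω : ReductionData.{u} n p h e m D R,
        (∀ s, T.output (coeffInput ω.A ω.f) s = ω.rem.coeff s) ∧
        T.cost (coeffInput ω.A ω.f) ≤
          11 * (p * (h + 1)) * (m + 1) ^ (3 * (n * p * (h + 1) * (e + h + 1))) *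
            (D + 1) ^ (3 * (n * (e + h + 1))) := by
  -- Without any data of these parameters every tree will do; otherwise an instance supplies `m ≥ 1`
  -- and `n ≥ 1` when `p ≠ 0`.
  rcases isEmpty_or_nonempty (ReductionData.{u} n p h e m D R) with hΩ | ⟨⟨ω₀⟩⟩
  · exact ⟨.halt fun _ => Sum.inr 0, fun ω => hΩ.elim ω⟩
  obtain ⟨N, hN⟩ : ∃ N, (m + 1) ^ (p * (h + 1)) * (D + 1) = N + 1 :=
    Nat.exists_eq_succ_of_ne_zero (by positivity)
  obtain ⟨T, hT⟩ := (solves_rem.{u} (R := R) (e := e) hN rfl).exists_compTree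
  refine ⟨T, fun ω => ⟨(hT ω).1, (hT ω).2.trans ?_⟩⟩
  have hcard : (Finset.univ ×ˢ Finset.range (e + h + 1) : Finset (Deriv n)).card =
      n * (e + h + 1) := by
    simp
  rw [boxCard, hcard]
  refine (reduction_cost_le fun hp => ?_).trans (le_of_eq ?_)
  · obtain ⟨hm, hn⟩ := ω₀.one_le ⟨0, Nat.pos_of_ne_zero hp⟩
    constructor
    -- The number `k` of variables satisfies `k ≤ 2^k ≤ (N+1)^k`, where `N + 1 ≥ 2` because `m ≥ 1`.
    · refine (Nat.lt_two_pow_self).le.trans (Nat.pow_le_pow_left ?_ _)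
      rw [← hN]
      calc 2 ≤ m + 1 := by lia
        _ ≤ (m + 1) ^ (p * (h + 1)) := Nat.le_self_pow (by positivity) _
        _ ≤ _ := Nat.le_mul_of_pos_right _ (Nat.succ_pos _)
    · exact Nat.le_self_pow (by positivity) _
  · have h1 : 3 * (n * p * (h + 1) * (e + h + 1)) = p * (h + 1) * (n * (e + h + 1) * 3) := by
      ring
    rw [← hN, h1, mul_comm 3 (n * (e + h + 1)), mul_pow, mul_pow, ← pow_mul, ← pow_mul,
      ← pow_mul, ← mul_assoc]

end Main

end DiffRed

theorem theorem3p1 :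
    ∃ c₁ c₂ c₃ : ℕ, ∀ (n p h e m D : ℕ) (R : Ranking n),
      ∃ T : CompTree ((Fin p × Mon n) ⊕ Mon n) (Mon n),
        ∀ (F : Type u) [Field F] [CharZero F] [Differential F]
          (A : Fin p → DiffPoly F n) (f : DiffPoly F n),
          R.IsAutoReduced A →
          order f = h →
          f.totalDegree = D →
          (Finset.univ.sup fun i => order (A i)) = e →
          (Finset.univ.sup fun i => (A i).totalDegree) = m →
          ∃ r : DiffPoly F n,
            R.IsDifferentialRemainder A f r ∧
            (∀ r', R.IsDifferentialRemainder A f r' → r' = r) ∧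
            (∀ i, R.IsReduced r (A i)) ∧
            (∃ (u : Fin p → Deriv n) (a b : Fin p → ℕ), (∀ i, R.IsLeader (A i) (u i)) ∧
              (∏ i, separant (u i) (A i) ^ a i * initial (u i) (A i) ^ b i) * f - r
                ∈ diffIdeal A) ∧
            r.totalDegree ≤ (m + 1) ^ (p * (h + 1)) * (D + 1) - 1 ∧
            (∀ s, T.output (coeffInput A f) s = r.coeff s) ∧
            T.cost (coeffInput A f) ≤
              c₁ * (p * (h + 1)) * (m + 1) ^ (c₂ * (n * p * (h + 1) * (e + h + 1))) *
                (D + 1) ^ (c₃ * (n * (e + h + 1))) := by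
  -- Per divisor, in units of `B^3`: 6 for tests and pseudo-division, 4 for derivation and 1 for the
  -- initial tests. Both exponents 3 come from `B^3`.
  refine ⟨11, 3, 3, fun n p h e m D R => ?_⟩
  obtain ⟨T, hT⟩ := exists_compTree.{u} n p h e m D R
  refine ⟨T, fun F _ _ _ A f hA hf hD he hm => ?_⟩
  let ω : ReductionData.{u} n p h e m D R := ⟨F, A, f, hA, hf, hD, he, hm⟩
  obtain ⟨h1, h2, h3, h4⟩ := ω.exists_remainder.choose_spec
  exact ⟨ω.rem, h1, fun r' hr' => h1.unique hr', h2, h3, h4, (hT ω).1, (hT ω).2⟩
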